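/- Setting. Let $\mathcal P$ be a probability distribution on an instance space $\mathcal X$, let $\mathbb C$ be a (measurable) class of binary classifiers on $\mathcal X$ of VC dimension $d$ with $1\le d<\infty$, and let $X_1,X_2,\dots$ be i.i.d. with law $\mathcal P$. For $\Delta\in(0,1]$ let $S_\Delta$ be the set of sequences $\mathbf h^*=(h^*_t)_{t\ge1}$ in $\mathbb C$ with $\mathcal P(x: h^*_{t}(x)\neq h^*_{t+1}(x))\le\Delta$ for all $t$; the label of $X_t$ is $Y_t=h^*_t(X_t)$, where $\mathbf h^*\in S_\Delta$ is fixed and non-random. Write ${\rm Log}(x)=\ln\max\{x,e\}$, $\lceil x\rceil_2=2^{\lceil\log_2 x\rceil}$ for $x\ge1$, ${\rm DIS}(\mathcal H)=\{x:\exists h,g\in\mathcal H,\ h(x)\ne g(x)\}$, ${\rm B}(h,r)=\{g\in\mathbb C:\mathcal P(x:g(x)\ne h(x))\le r\}$, and $$\theta_{\mathbb C}(r_0)=\sup_{h\in\mathbb C}\ \sup_{r>r_0}\frac{\mathcal P({\rm DIS}({\rm B}(h,r)))}{r}.$$ Algorithm ${\rm DriftingActive}$, with batch length $M$ and thresholds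 $\hat T_k$. For $i=1,2,\dots$ it does the following with $t=M(i-1)$. Let $\hat h_0$ be an arbitrary element of $\mathbb C$ and $V_0=\mathbb C$; predict $\hat Y_{t+1}=\hat h_0(X_{t+1})$. For $k=0,1,\dots,\log_2(M/2)$: for each $s=2^k+1,\dots,2^{k+1}$, predict $\hat Y_{t+s}=\hat h_k(X_{t+s})$ and, if $X_{t+s}\in{\rm DIS}(V_k)$, request the label $Y_{t+s}$; let $Q_k$ be the list of the pairs $(X_{t+s},Y_{t+s})$ so obtained (repetitions are counted); let $\hat h_{k+1}$ be any minimizer over $h\in V_k$ of $\sum_{(x,y)\in Q_k}\mathbf 1[h(x)\ne y]$ (an arbitrary classifier if $V_k=\emptyset$); and let $$V_{k+1}=\Big\{h\in V_k:\ \sum_{(x,y)\in Q_k}\big(\mathbf 1[h(x)\ne y]-\mathbf 1[\hat h_{k+1}(x)\ne y]\big)\le\hat T_k\Big\}.$$ The choices of $\hat h_0$ and of the minimizers are measurable and may depend on anything available at that time, but not on later instances. Theorem. There are universal constants $c_1\in[1,\infty)$ and $K\in(0,\infty)$ such that the following holds for all $\mathcal X,\mathcal P,\mathbb C,d,\Delta$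 and $\mathbf h^*\in S_\Delta$ as above. Put $$M=\Big\lceil c_1\sqrt{d/\Delta}\Big\rceil_2,\qquad \hat T_k=\log_2\frac1{\sqrt{d\Delta}}+2^{2k+2}e\,\Delta,\qquad \epsilon_\Delta=\sqrt{d\Delta}\,{\rm Log}\frac1{d\Delta}.$$ Then, for every $T\ge M$, among the first $T$ instances the algorithm ${\rm DriftingActive}$ makes an expected number of mistakes ($\hat Y_t\ne Y_t$) that is at most $$K\,\epsilon_\Delta\,{\rm Log}(d/\Delta)\,T$$ and requests an expected number of labels that is at most $$K\,\theta_{\mathbb C}(\epsilon_\Delta)\,\epsilon_\Delta\,{\rm Log}(d/\Delta)\,T.$$ -/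

import Mathlib

open MeasureTheory ProbabilityTheory
open scoped ENNReal

namespace Drift

/-- `Log x = ln (max x e)`. -/
noncomputable def Log (x : ℝ) : ℝ := Real.log (max x (Real.exp 1))

section Concepts

variable {𝒳 : Type*}

/-- A finite set of points is shattered by `C` if every labelling of it is realised in `C`. -/
def Shatters (C : Set (𝒳 → Bool)) (S : Finset 𝒳) : Prop :=
  ∀ y : 𝒳 → Bool, ∃ h ∈ C, ∀ x ∈ S, h x = y x

/-- The VC dimension of a concept space: the supremum of the sizes of shattered finite sets. -/
noncomputable def vcDim (C : Set (𝒳 → Bool)) : ℕ∞ :=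
  ⨆ (S : Finset 𝒳) (_ : Shatters C S), (S.card : ℕ∞)

/-- The region of disagreement `DIS(H)`. -/
def DIS (H : Set (𝒳 → Bool)) : Set 𝒳 := {x | ∃ h ∈ H, ∃ g ∈ H, h x ≠ g x}

variable [MeasurableSpace 𝒳]

/-- `P (x : h x ≠ g x)`. -/
noncomputable def disagreement (P : Measure 𝒳) (h g : 𝒳 → Bool) : ℝ := P.real {x | h x ≠ g x}

/-- The ball `B(h, r)` in the concept space. -/
def ball (P : Measure 𝒳) (C : Set (𝒳 → Bool)) (h : 𝒳 → Bool) (r : ℝ) : Set (𝒳 → Bool) :=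
  {g ∈ C | disagreement P g h ≤ r}

/-- The disagreement coefficient `θ_h(r₀) = sup_{r > r₀} P(DIS(B(h, r))) / r`, for `r₀ ≥ 0`. -/
noncomputable def disCoeff (P : Measure 𝒳) (C : Set (𝒳 → Bool)) (h : 𝒳 → Bool) (r₀ : ℝ) : ℝ≥0∞ :=
  ⨆ (r : ℝ) (_ : r₀ < r), P (DIS (ball P C h r)) / ENNReal.ofReal r

/-- The worst-case disagreement coefficient `θ_C(r₀) = sup_{h ∈ C} θ_h(r₀)`. -/
noncomputable def worstDisCoeff (P : Measure 𝒳) (C : Set (𝒳 → Bool)) (r₀ : ℝ) : ℝ≥0∞ :=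
  ⨆ h ∈ C, disCoeff P C h r₀

/-- Measurability of a concept space: every concept is measurable and, for every concept `g` and
every real `r`, the set of `n`-point samples on which a given labelling is realised by a concept
at distance more than `r` from `g` is measurable up to null sets. (For `r < 0` the restriction on
the distance is void. Every countable set of measurable concepts has the property.) -/
structure MeasurableClass (P : Measure 𝒳) (C : Set (𝒳 → Bool)) : Prop where
  measurable : ∀ h ∈ C, Measurable h
  nullMeasurable : ∀ g ∈ C, ∀ r : ℝ, ∀ (n : ℕ) (y : Fin n → Bool),
    NullMeasurableSet {x : Fin n → 𝒳 | ∃ h ∈ C, r < disagreement P h g ∧ ∀ i, h (x i) = y i}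
      (Measure.pi fun _ : Fin n => P)

/-- The set `S_Δ` of target sequences in `C` with drift rate at most `Δ`. The sequence is indexed
from `0`: `hs n` is the target at the `(n+1)`-st instance. -/
def driftClass (P : Measure 𝒳) (C : Set (𝒳 → Bool)) (Δ : ℝ) : Set (ℕ → 𝒳 → Bool) :=
  {hs | (∀ n, hs n ∈ C) ∧ ∀ n, disagreement P (hs n) (hs (n + 1)) ≤ Δ}

end Concepts

section Algorithm

variable {𝒳 : Type*}

open Classical in
/-- Number of mistakes of `h` on the labelled points queried in block `k` of a batch, when the
current set of candidates is `V`. The batch consists of the points `x 0, x 1, …` with labels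
`y 0, y 1, …`; the `s`-th instance of the batch is `x (s - 1)`, so block `k`, which consists of the
instances `s = 2^k + 1, …, 2^(k+1)`, has the positions `2^k ≤ p < 2^(k+1)`. -/
noncomputable def queriedErrors (x : ℕ → 𝒳) (y : ℕ → Bool) (V : Set (𝒳 → Bool)) (k : ℕ)
    (h : 𝒳 → Bool) : ℕ :=
  ((Finset.Ico (2 ^ k) (2 ^ (k + 1))).filter fun p => x p ∈ DIS V ∧ h (x p) ≠ y p).card

/-- The candidate sets `V_k` of the subroutine `Active` on a batch with points `x` and labels `y`,
with thresholds `thr` and with the classifiers `g k` in the role of `ĥ_k`. -/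
def versionSpace (C : Set (𝒳 → Bool)) (thr : ℕ → ℝ) (x : ℕ → 𝒳) (y : ℕ → Bool)
    (g : ℕ → 𝒳 → Bool) : ℕ → Set (𝒳 → Bool)
  | 0 => C
  | k + 1 => {h ∈ versionSpace C thr x y g k |
      (queriedErrors x y (versionSpace C thr x y g k) k h : ℝ)
        - queriedErrors x y (versionSpace C thr x y g k) k (g (k + 1)) ≤ thr k}

variable {Ω : Type*}

/-- The candidate set `V_k` in the batch with (zero-based) index `i`, which consists of the
instances `M * i, …, M * i + M - 1` (also zero-based). -/
def batchVersionSpace (C : Set (𝒳 → Bool)) (thr : ℕ → ℝ) (M : ℕ) (hs : ℕ → 𝒳 → Bool)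
    (X : ℕ → Ω → 𝒳) (hhat : ℕ → ℕ → Ω → 𝒳 → Bool) (i k : ℕ) (ω : Ω) : Set (𝒳 → Bool) :=
  versionSpace C thr (fun p => X (M * i + p) ω) (fun p => hs (M * i + p) (X (M * i + p) ω))
    (fun j => hhat i j ω) k

variable [MeasurableSpace 𝒳] {mΩ : MeasurableSpace Ω}

/-- `hhat i k` is the classifier `ĥ_k` in batch `i` of an execution of `DriftingActive` with batch
length `M` (a power of two) and thresholds `thr`, on the data `X` labelled by `hs`, where `ℱ n` is
the information available before instance `n`. In each batch, `ĥ_0` is an arbitrary element of `C`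
chosen before the batch starts, and for `k = 0, 1, …, log₂ (M / 2)` the classifier `ĥ_{k+1}` is,
after block `k`, a minimiser over `V_k` of the number of mistakes on the queried points of the
block. Ties are broken arbitrarily, possibly at random, and `ĥ_{k+1}` is arbitrary if `V_k` is
empty. -/
structure IsDriftingActiveRun (C : Set (𝒳 → Bool)) (thr : ℕ → ℝ) (M : ℕ) (hs : ℕ → 𝒳 → Bool)
    (X : ℕ → Ω → 𝒳) (ℱ : Filtration ℕ mΩ) (hhat : ℕ → ℕ → Ω → 𝒳 → Bool) : Prop where
  init_mem : ∀ i ω, hhat i 0 ω ∈ C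
  init_measurable : ∀ i, Measurable[(ℱ (M * i)).prod inferInstance]
    fun q : Ω × 𝒳 => hhat i 0 q.1 q.2
  step_measurable : ∀ i k, 2 ^ (k + 1) ≤ M →
    Measurable[(ℱ (M * i + 2 ^ (k + 1))).prod inferInstance]
      fun q : Ω × 𝒳 => hhat i (k + 1) q.1 q.2
  step_argmin : ∀ i k ω, 2 ^ (k + 1) ≤ M →
    (batchVersionSpace C thr M hs X hhat i k ω).Nonempty →
    hhat i (k + 1) ω ∈ batchVersionSpace C thr M hs X hhat i k ω ∧
    ∀ h ∈ batchVersionSpace C thr M hs X hhat i k ω,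
      queriedErrors (fun p => X (M * i + p) ω) (fun p => hs (M * i + p) (X (M * i + p) ω))
          (batchVersionSpace C thr M hs X hhat i k ω) k (hhat i (k + 1) ω) ≤
        queriedErrors (fun p => X (M * i + p) ω) (fun p => hs (M * i + p) (X (M * i + p) ω))
          (batchVersionSpace C thr M hs X hhat i k ω) k h

open Classical in
/-- Number of mistakes among the first `T` instances. Instance `n` has position `n % M` in batch
`n / M`, and it lies in block `k = Nat.log 2 (n % M)`. The first instance of a batch (position `0`)
is predicted by `ĥ_0`, in accordance with `Nat.log 2 0 = 0`. -/
noncomputable def numMistakes (M : ℕ) (hs : ℕ → 𝒳 → Bool) (X : ℕ → Ω → 𝒳)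
    (hhat : ℕ → ℕ → Ω → 𝒳 → Bool) (T : ℕ) (ω : Ω) : ℕ :=
  ((Finset.range T).filter fun n =>
    hhat (n / M) (Nat.log 2 (n % M)) ω (X n ω) ≠ hs n (X n ω)).card

open Classical in
/-- Number of labels requested among the first `T` instances: the label of instance `n` in block
`k` is requested if the instance lies in `DIS(V_k)`; the label of the first instance of a batch is
never requested. -/
noncomputable def numQueries (C : Set (𝒳 → Bool)) (thr : ℕ → ℝ) (M : ℕ) (hs : ℕ → 𝒳 → Bool)
    (X : ℕ → Ω → 𝒳) (hhat : ℕ → ℕ → Ω → 𝒳 → Bool) (T : ℕ) (ω : Ω) : ℕ :=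
  ((Finset.range T).filter fun n => n % M ≠ 0 ∧
    X n ω ∈ DIS (batchVersionSpace C thr M hs X hhat (n / M) (Nat.log 2 (n % M)) ω)).card

end Algorithm

/-- The batch length `⌈c₁ √(d/Δ)⌉₂`, where `⌈x⌉₂ = 2 ^ ⌈log₂ x⌉` for `x ≥ 1`. -/
noncomputable def batchLength (c₁ : ℝ) (d : ℕ) (Δ : ℝ) : ℕ :=
  2 ^ ⌈Real.logb 2 (c₁ * √(d / Δ))⌉₊

/-- The threshold `T̂_k = log₂ (1 / √(dΔ)) + 2^(2k+2) e Δ`. -/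
noncomputable def threshold (d : ℕ) (Δ : ℝ) (k : ℕ) : ℝ :=
  Real.logb 2 (1 / √(d * Δ)) + 2 ^ (2 * k + 2) * Real.exp 1 * Δ

/-- `ε_Δ = √(dΔ) Log (1 / (dΔ))`. -/
noncomputable def epsDelta (d : ℕ) (Δ : ℝ) : ℝ := √(d * Δ) * Log (1 / (d * Δ))

end Drift

/-!
The batch length `M` is of order `√(d / Δ)`, so within a batch the target drifts by at most
`M Δ ≍ √(dΔ)`, and every batch can be analysed with its first target `h₀` as reference.

In block `j`, which has `2 ^ j` instances, `h₀` makes at most `2 * 4 ^ j * Δ` mistakes in expectation; by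
Chernoff's bound (`measure_count_le`) it makes at most `threshold d Δ j` of them, except with
probability `√(dΔ)`, and therefore survives. A survivor makes at most one threshold more mistakes
on the queried points than the minimiser, hence than `h₀`. Since two candidates can disagree only
where labels are queried, the survivor and `h₀` disagree on at most
`3 * threshold d Δ j` instances of the block (`versionSpace_good`). A relative
Vapnik–Chervonenkis bound
(`measure_exists_far_of_few_le`) turns this into a distance of at most
`survivorRadius d Δ j ≍ d Log (1 / (dΔ)) / 2 ^ j`, again except with probability `√(dΔ)`.
The bound is proved by symmetrization: a ghost sample is added, corresponding points of the two
samples are exchanged at random, and the weight `2⁻¹` per disagreement in the first half and `3 / 2` per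
disagreement in the second has mean at most one, which leaves the Sauer–Shelah count of patterns.

Whether a batch is typical up to block `k` is decided before the block starts, so a point of the
block is independent of it. A mistake in block `j + 1` thus has probability at most the radius plus
the drift plus the probability of an atypical batch. A query has probability at most
`P (DIS (ball h₀ radius))`, which the disagreement coefficient controls as the radius exceeds
`epsDelta d Δ`, plus the probability of an atypical batch times `P (DIS C)`. The radii add up to a
harmonic sum over the positions of a batch, of order `d Log (1 / (dΔ)) Log (d / Δ)`; division by `M`
gives the rate, because `d ≤ M √(dΔ)`.

Balls in the concept space need not have measurable regions of disagreement, so outer measures are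
used throughout. Null measurability is needed only for the ghost event, where expectation and sum
are exchanged, and for the queries themselves; both are determined by finitely many
pattern events (`nullMeasurableSet_of_determined`).
-/

namespace Drift

/-! ### The number of patterns on a sample -/

section Patterns

variable {𝒳 ι : Type*}

/-- The labellings of the points `z i` that are realised by concepts in `C`. -/
def patterns (C : Set (𝒳 → Bool)) (z : ι → 𝒳) : Set (ι → Bool) :=
  {a | ∃ h ∈ C, ∀ i, h (z i) = a i}

lemma card_le_of_shatters {C : Set (𝒳 → Bool)} {d : ℕ} (hd : vcDim C ≤ d) {S : Finset 𝒳}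
    (hS : Shatters C S) : S.card ≤ d := by
  have h : (S.card : ℕ∞) ≤ vcDim C :=
    le_iSup₂ (f := fun (S : Finset 𝒳) (_ : Shatters C S) => (S.card : ℕ∞)) S hS
  exact_mod_cast h.trans hd

/-- The Sauer–Shelah lemma for labellings of a sample with possible repetitions, in the form
`(e n / d) ^ d`. -/
lemma ncard_patterns_le [Fintype ι] {C : Set (𝒳 → Bool)} {d : ℕ} (hd : vcDim C ≤ d)
    (hd1 : 1 ≤ d) (hn : d ≤ Fintype.card ι) (z : ι → 𝒳) :
    ((patterns C z).ncard : ℝ) ≤ Real.exp (d * (1 + Real.log (Fintype.card ι / d))) := by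
  classical
  set n := Fintype.card ι with hndef
  let φ : (ι → Bool) → Finset ι := fun a => Finset.univ.filter fun i => a i = true
  have hφ : Function.Injective φ := by
    intro a b hab
    funext i
    have := congrArg (fun s => i ∈ s) hab
    simp only [φ, Finset.mem_filter, Finset.mem_univ, true_and, eq_iff_iff] at this
    exact Bool.eq_iff_iff.2 this
  have hfin : (patterns C z).Finite := Set.toFinite _
  set 𝒜 : Finset (Finset ι) := hfin.toFinset.image φ with h𝒜
  have hcard : (patterns C z).ncard = 𝒜.card := by
    rw [h𝒜, Finset.card_image_of_injective _ hφ, Set.ncard_eq_toFinset_card _ hfin]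
  have hsub : ∀ s ∈ 𝒜.shatterer, s.card ≤ d := by
    intro s hs
    rw [Finset.mem_shatterer] at hs
    have key : ∀ t ⊆ s, ∃ h ∈ C, ∀ i ∈ s, (h (z i) = true ↔ i ∈ t) := by
      intro t ht
      obtain ⟨u, hu, hut⟩ := hs ht
      simp only [h𝒜, Finset.mem_image, Set.Finite.mem_toFinset] at hu
      obtain ⟨a, ⟨h, hC, ha⟩, rfl⟩ := hu
      refine ⟨h, hC, fun i hi => ?_⟩
      rw [← hut, ha i]
      simp [φ, hi]
    have hinj : Set.InjOn z s := by
      intro i hi j hj hij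
      by_contra hne
      obtain ⟨h, -, hh⟩ := key {i} (by simpa using hi)
      have h1 := (hh i hi).2 (by simp)
      rw [hij] at h1
      have := (hh j hj).1 h1
      simp only [Finset.mem_singleton] at this
      exact hne this.symm
    rw [← Finset.card_image_of_injOn hinj]
    refine card_le_of_shatters hd ?_
    intro y
    obtain ⟨h, hC, hh⟩ := key (s.filter fun i => y (z i) = true) (Finset.filter_subset _ _)
    refine ⟨h, hC, fun x hx => ?_⟩
    obtain ⟨i, hi, rfl⟩ := Finset.mem_image.1 hx
    have := hh i hi
    simp only [Finset.mem_filter, hi, true_and] at this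
    exact Bool.eq_iff_iff.2 this
  have hd0 : (0 : ℝ) < d := by exact_mod_cast hd1
  have hn0 : (0 : ℝ) < n := hd0.trans_le (by exact_mod_cast hn)
  -- every set of size at most `d` has weight at least one in `∑ (d / n) ^ (#s - d)`
  set x : ℝ := d / n with hx
  have hx0 : 0 < x := by positivity
  have hx1 : x ≤ 1 := by
    rw [hx, div_le_one hn0]; exact_mod_cast hn
  have h1 : (𝒜.shatterer.card : ℝ) * x ^ d ≤ (1 + x) ^ n := by
    calc (𝒜.shatterer.card : ℝ) * x ^ d = ∑ s ∈ 𝒜.shatterer, x ^ d := by simp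
      _ ≤ ∑ s ∈ 𝒜.shatterer, x ^ s.card :=
        Finset.sum_le_sum fun s hs => pow_le_pow_of_le_one hx0.le hx1 (hsub s hs)
      _ ≤ ∑ s ∈ (Finset.univ : Finset ι).powerset, x ^ s.card :=
        Finset.sum_le_sum_of_subset_of_nonneg (fun s _ => by simp) fun s _ _ => by positivity
      _ = (1 + x) ^ n := by
        have := Finset.sum_pow_mul_eq_add_pow x 1 (Finset.univ : Finset ι)
        simp only [one_pow, mul_one] at this
        rw [this, add_comm, hndef, Finset.card_univ]
  have h2 : (1 + x) ^ n ≤ Real.exp d := by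
    calc (1 + x) ^ n ≤ (Real.exp x) ^ n := by
          gcongr; rw [add_comm]; exact Real.add_one_le_exp x
      _ = Real.exp d := by
        rw [← Real.exp_nat_mul, hx]; congr 1; field_simp
  have h3 : Real.exp (d * (1 + Real.log (n / d))) * x ^ d = Real.exp d := by
    have : x ^ d = Real.exp (d * Real.log x) := by
      rw [Real.exp_nat_mul, Real.exp_log hx0]
    rw [this, ← Real.exp_add, show Real.log (n / d) = - Real.log x by
      rw [hx, ← Real.log_inv, inv_div]]
    congr 1; ring
  have h4 : ((patterns C z).ncard : ℝ) ≤ 𝒜.shatterer.card := by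
    rw [hcard]; exact_mod_cast Finset.card_le_card_shatterer 𝒜
  have hxd : 0 < x ^ d := by positivity
  refine h4.trans (le_of_mul_le_mul_right ?_ hxd)
  rw [h3]; exact h1.trans h2

end Patterns

/-! ### Random exchanges in a double sample -/

section Swaps

variable {ι : Type*}

/-- The permutation of `ι ⊕ ι` that exchanges the two copies of `i` whenever `σ i` is true. -/
def swapIdx (σ : ι → Bool) : ι ⊕ ι → ι ⊕ ι
  | .inl i => if σ i then .inr i else .inl i
  | .inr i => if σ i then .inl i else .inr i

lemma swapIdx_involutive (σ : ι → Bool) : Function.Involutive (swapIdx σ) := by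
  rintro (i | i) <;> by_cases h : σ i <;> simp [swapIdx, h]

/-- The number of true values in the first half of a labelling of a double sample. -/
def countL [Fintype ι] (a : ι ⊕ ι → Bool) : ℕ :=
  (Finset.univ.filter fun i => a (.inl i) = true).card

/-- The number of true values in the second half of a labelling of a double sample. -/
def countR [Fintype ι] (a : ι ⊕ ι → Bool) : ℕ :=
  (Finset.univ.filter fun i => a (.inr i) = true).card

/-- For a fixed labelling of a double sample, only a small fraction of the `2 ^ card ι` exchanges
leaves at most `τ` true values in the first half and at least `s` in the second. The weight
`2⁻¹ ^ countL * (3 / 2) ^ countR` averages to at most one over the exchanges. -/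
lemma card_swaps_le [Fintype ι] (a : ι ⊕ ι → Bool) (τ s : ℝ) :
    (({σ : ι → Bool | (countL (a ∘ swapIdx σ) : ℝ) ≤ τ ∧ s ≤ countR (a ∘ swapIdx σ)}.ncard : ℕ) : ℝ)
      ≤ 2 ^ Fintype.card ι * Real.exp (τ * Real.log 2 - s * Real.log (3 / 2)) := by
  classical
  set E : Set (ι → Bool) :=
    {σ : ι → Bool | (countL (a ∘ swapIdx σ) : ℝ) ≤ τ ∧ s ≤ countR (a ∘ swapIdx σ)}
  let φ : ι → Bool → ℝ := fun i b =>
    (if a (swapIdx (fun _ => b) (.inl i)) = true then (1 / 2 : ℝ) else 1) *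
      (if a (swapIdx (fun _ => b) (.inr i)) = true then (3 / 2 : ℝ) else 1)
  have hφ0 : ∀ i b, 0 ≤ φ i b := fun i b => by
    simp only [φ]; split_ifs <;> norm_num
  have hφ : ∀ σ : ι → Bool, ∏ i, φ i (σ i) =
      (1 / 2 : ℝ) ^ countL (a ∘ swapIdx σ) * (3 / 2 : ℝ) ^ countR (a ∘ swapIdx σ) := by
    intro σ
    have e1 : ∀ i, swapIdx (fun _ => σ i) (.inl i : ι ⊕ ι) = swapIdx σ (.inl i) := fun i => rfl
    have e2 : ∀ i, swapIdx (fun _ => σ i) (.inr i : ι ⊕ ι) = swapIdx σ (.inr i) := fun i => rfl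
    simp only [φ, e1, e2, Finset.prod_mul_distrib, Finset.prod_ite, Finset.prod_const,
      one_pow, mul_one, countL, countR, Function.comp]
  have hlow : ∀ σ ∈ E, Real.exp (s * Real.log (3 / 2) - τ * Real.log 2) ≤ ∏ i, φ i (σ i) := by
    rintro σ ⟨h1, h2⟩
    rw [hφ, ← Real.rpow_natCast, ← Real.rpow_natCast, Real.rpow_def_of_pos (by norm_num),
      Real.rpow_def_of_pos (by norm_num), ← Real.exp_add]
    refine Real.exp_le_exp.2 ?_
    rw [one_div, Real.log_inv]
    have l2 : 0 ≤ Real.log 2 := Real.log_nonneg (by norm_num)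
    have l3 : 0 ≤ Real.log (3 / 2) := Real.log_nonneg (by norm_num)
    nlinarith [mul_le_mul_of_nonneg_right h1 l2, mul_le_mul_of_nonneg_right h2 l3]
  have htot : ∑ σ : ι → Bool, ∏ i, φ i (σ i) ≤ 2 ^ Fintype.card ι := by
    have := Finset.prod_univ_sum (fun _ : ι => (Finset.univ : Finset Bool)) φ
    rw [Fintype.piFinset_univ] at this
    rw [← this]
    calc ∏ i, ∑ b, φ i b ≤ ∏ _i : ι, (2 : ℝ) := by
          refine Finset.prod_le_prod (fun i _ => Finset.sum_nonneg fun b _ => hφ0 i b) fun i _ => ?_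
          rw [Fintype.sum_bool]
          simp only [φ, swapIdx]
          simp only [if_true, if_false, Bool.false_eq_true]
          split_ifs <;> norm_num
      _ = 2 ^ Fintype.card ι := by simp
  have hE : E.Finite := Set.toFinite _
  rw [Set.ncard_eq_toFinset_card _ hE]
  have h := calc (hE.toFinset.card : ℝ) * Real.exp (s * Real.log (3 / 2) - τ * Real.log 2)
      = ∑ _σ ∈ hE.toFinset, Real.exp (s * Real.log (3 / 2) - τ * Real.log 2) := by simp
    _ ≤ ∑ σ ∈ hE.toFinset, ∏ i, φ i (σ i) :=
        Finset.sum_le_sum fun σ hσ => hlow σ (hE.mem_toFinset.1 hσ)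
    _ ≤ ∑ σ : ι → Bool, ∏ i, φ i (σ i) :=
        Finset.sum_le_sum_of_subset_of_nonneg (Finset.subset_univ _) fun σ _ _ =>
          Finset.prod_nonneg fun i _ => hφ0 i _
    _ ≤ 2 ^ Fintype.card ι := htot
  have hpos := Real.exp_pos (s * Real.log (3 / 2) - τ * Real.log 2)
  refine le_of_mul_le_mul_right ?_ hpos
  rw [mul_assoc, ← Real.exp_add]
  simpa using h

end Swaps

/-! ### Events determined by finitely many events -/

section FiniteEvents

variable {Ω κ : Type*} {mΩ : MeasurableSpace Ω} {μ : Measure Ω}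

/-- An event that is determined by the truth values of finitely many null measurable events is
null measurable. -/
lemma nullMeasurableSet_of_determined [Finite κ] {p : κ → Ω → Prop}
    (hp : ∀ i, NullMeasurableSet {ω | p i ω} μ) {S : Set Ω}
    (hS : ∀ ω ω', (∀ i, p i ω ↔ p i ω') → ω ∈ S → ω' ∈ S) : NullMeasurableSet S μ := by
  classical
  have hrep : S = ⋃ v ∈ {v : κ → Prop | ∃ ω ∈ S, ∀ i, p i ω ↔ v i},
      ⋂ i, {ω | p i ω ↔ v i} := by
    ext ω
    simp only [Set.mem_iUnion, Set.mem_iInter, Set.mem_ofPred_eq, exists_prop]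
    constructor
    · intro h
      exact ⟨fun i => p i ω, ⟨ω, h, fun i => Iff.rfl⟩, fun i => Iff.rfl⟩
    · rintro ⟨v, ⟨ω', h', hv'⟩, hv⟩
      exact hS ω' ω (fun i => (hv' i).trans (hv i).symm) h'
  rw [hrep]
  refine NullMeasurableSet.biUnion (Set.to_countable _) fun v _ => ?_
  refine NullMeasurableSet.iInter fun i => ?_
  by_cases hv : v i
  · simpa [hv] using hp i
  · have h := (hp i).compl
    convert h using 1
    ext ω
    simp [hv]

end FiniteEvents

/-! ### Product measures and Chernoff's bound -/

section ProductMeasure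

variable {𝒳 : Type*} [MeasurableSpace 𝒳] (P : Measure 𝒳) [IsProbabilityMeasure P]

lemma measurePreserving_comp_equiv {ι κ : Type*} [Fintype ι] [Fintype κ] (e : ι ≃ κ) :
    MeasurePreserving (fun z : κ → 𝒳 => z ∘ e) (Measure.pi fun _ => P) (Measure.pi fun _ => P) := by
  have h := measurePreserving_piCongrLeft (fun _ : ι => P) e.symm
  convert h using 1
  funext z i
  obtain ⟨j, rfl⟩ := e.symm.surjective i
  exact (by simp : (z ∘ e) (e.symm j) = z j).trans
    (Equiv.piCongrLeft_apply_apply (fun _ : ι => 𝒳) e.symm z j).symm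

lemma measurePreserving_sumElim {ι κ : Type*} [Fintype ι] [Fintype κ] :
    MeasurePreserving (fun z : (ι → 𝒳) × (κ → 𝒳) => (Sum.elim z.1 z.2 : ι ⊕ κ → 𝒳))
      ((Measure.pi fun _ => P).prod (Measure.pi fun _ => P)) (Measure.pi fun _ => P) := by
  have h := (measurePreserving_sumPiEquivProdPi (fun _ : ι ⊕ κ => P)).symm
  convert h using 1
  funext z i
  rcases i with i | i <;> rfl

open Classical in
/-- Chernoff's bound for the number of indices `i` with `x i ∈ A i`, in both directions: the sign of
`l` is arbitrary. -/
lemma measure_count_le {ι : Type*} [Fintype ι] {A : ι → Set 𝒳} (hA : ∀ i, MeasurableSet (A i))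
    (l t : ℝ) :
    (Measure.pi fun _ : ι => P).real
        {x | t ≤ l * (Finset.univ.filter fun i => x i ∈ A i).card} ≤
      Real.exp ((Real.exp l - 1) * ∑ i, P.real (A i) - t) := by
  let f : ι → 𝒳 → ℝ := fun i x => 1 + (A i).indicator (fun _ => Real.exp l - 1) x
  have hf : ∀ i x, f i x = if x ∈ A i then Real.exp l else 1 := by
    intro i x
    by_cases h : x ∈ A i <;> simp [f, h]
  have hind : ∀ i, Integrable ((A i).indicator fun _ => Real.exp l - 1) P := fun i =>
    (integrable_const _).indicator (hA i)
  have hint : ∀ i, Integrable (f i) P := fun i => (integrable_const _).add (hind i)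
  have hval : ∀ i, ∫ x, f i x ∂P = 1 + (Real.exp l - 1) * P.real (A i) := by
    intro i
    simp only [f]
    rw [integral_add (integrable_const _) (hind i), integral_indicator_const _ (hA i)]
    simp [mul_comm]
  have hprod : ∀ x : ι → 𝒳, ∏ i, f i (x i) =
      Real.exp (l * (Finset.univ.filter fun i => x i ∈ A i).card) := by
    intro x
    simp only [hf, Finset.prod_ite, Finset.prod_const, one_pow, mul_one]
    rw [← Real.exp_nat_mul, mul_comm]
  have hI : ∫ x : ι → 𝒳, ∏ i, f i (x i) ∂(Measure.pi fun _ => P) ≤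
      Real.exp ((Real.exp l - 1) * ∑ i, P.real (A i)) := by
    rw [integral_fintype_prod_eq_prod, Finset.mul_sum, Real.exp_sum]
    refine Finset.prod_le_prod (fun i _ => integral_nonneg fun x => ?_) fun i _ => ?_
    · rw [hf]; simp only [Pi.zero_apply]; positivity
    · rw [hval, add_comm]; exact Real.add_one_le_exp _
  have hM := mul_meas_ge_le_integral_of_nonneg (μ := Measure.pi fun _ : ι => P)
    (f := fun x : ι → 𝒳 => ∏ i, f i (x i))
    (ae_of_all _ fun x => by simp only [Pi.zero_apply]; rw [hprod]; positivity)
    (Integrable.fintype_prod hint) (Real.exp t)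
  have hset : {x : ι → 𝒳 | Real.exp t ≤ ∏ i, f i (x i)} =
      {x | t ≤ l * (Finset.univ.filter fun i => x i ∈ A i).card} := by
    ext x; simp only [Set.mem_ofPred_eq, hprod, Real.exp_le_exp]
  rw [hset] at hM
  rw [Real.exp_sub, le_div_iff₀ (Real.exp_pos _), mul_comm]
  exact hM.trans hI

end ProductMeasure

/-! ### A relative deviation bound by symmetrization -/

section Deviation

variable {𝒳 : Type*} [MeasurableSpace 𝒳] {P : Measure 𝒳} [IsProbabilityMeasure P]

lemma nullMeasurableSet_patterns {C : Set (𝒳 → Bool)} (hC : MeasurableClass P C)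
    {ι : Type*} [Fintype ι] (y : ι → Bool) :
    NullMeasurableSet {x : ι → 𝒳 | y ∈ patterns C x} (Measure.pi fun _ => P) := by
  rcases C.eq_empty_or_nonempty with rfl | ⟨g, hg⟩
  · simp [patterns]
  let e := Fintype.equivFin ι
  have h := (hC.nullMeasurable g hg (-1) _ (y ∘ e.symm)).preimage
    (measurePreserving_comp_equiv P e.symm).quasiMeasurePreserving
  convert h using 1
  ext x
  have hpos : ∀ h : 𝒳 → Bool, -1 < disagreement P h g := fun h =>
    lt_of_lt_of_le (by norm_num) measureReal_nonneg
  simp only [patterns, Set.mem_ofPred_eq, Set.mem_preimage, hpos, true_and, Function.comp]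
  constructor
  · rintro ⟨h, hC, hh⟩
    exact ⟨h, hC, fun i => hh _⟩
  · rintro ⟨h, hC, hh⟩
    exact ⟨h, hC, fun i => by simpa using hh (e i)⟩

/-- The event that some concept disagrees with `g` on at most `τ` points of the first half of a
double sample and on at least `s` points of the second half. -/
def ghostEvent (C : Set (𝒳 → Bool)) (g : 𝒳 → Bool) (ι : Type*) [Fintype ι] (τ s : ℝ) :
    Set (ι ⊕ ι → 𝒳) :=
  {z | ∃ a ∈ patterns C z, (countL (fun i => a i != g (z i)) : ℝ) ≤ τ ∧
    s ≤ countR (fun i => a i != g (z i))}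

lemma nullMeasurableSet_ghostEvent {C : Set (𝒳 → Bool)} (hC : MeasurableClass P C)
    {g : 𝒳 → Bool} (hg : Measurable g) (ι : Type*) [Fintype ι] (τ s : ℝ) :
    NullMeasurableSet (ghostEvent C g ι τ s) (Measure.pi fun _ => P) := by
  classical
  refine nullMeasurableSet_of_determined (κ := (ι ⊕ ι → Bool) ⊕ (ι ⊕ ι))
    (p := Sum.elim (fun y z => y ∈ patterns C z) (fun i z => g (z i) = true)) ?_ ?_
  · rintro (y | i)
    · exact nullMeasurableSet_patterns hC y
    · have : Measurable fun z : ι ⊕ ι → 𝒳 => g (z i) := hg.comp (measurable_pi_apply i)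
      exact (this (measurableSet_singleton true)).nullMeasurableSet
  · rintro z z' h ⟨a, ha, h1, h2⟩
    have hgz : ∀ i, g (z i) = g (z' i) := fun i => Bool.eq_iff_iff.2 (h (.inr i))
    refine ⟨a, (h (.inl a)).1 ha, ?_, ?_⟩
    · simpa only [hgz] using h1
    · simpa only [hgz] using h2

/-- Exchanging the two copies of each sample point at random bounds the probability of the ghost
event by the number of patterns times the bound for a single pattern. -/
lemma measure_ghostEvent_le {C : Set (𝒳 → Bool)} (hC : MeasurableClass P C) {d : ℕ}
    (hd : vcDim C ≤ d) (hd1 : 1 ≤ d) {g : 𝒳 → Bool} (hg : Measurable g) (ι : Type*) [Fintype ι]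
    (hn : d ≤ Fintype.card (ι ⊕ ι)) (τ s : ℝ) :
    (Measure.pi fun _ => P) (ghostEvent C g ι τ s) ≤
      ENNReal.ofReal (Real.exp (d * (1 + Real.log (Fintype.card (ι ⊕ ι) / d)) +
        (τ * Real.log 2 - s * Real.log (3 / 2)))) := by
  classical
  set Q : Measure (ι ⊕ ι → 𝒳) := Measure.pi fun _ => P
  set B := ghostEvent C g ι τ s
  set S := Real.exp (d * (1 + Real.log (Fintype.card (ι ⊕ ι) / d)))
  set w := Real.exp (τ * Real.log 2 - s * Real.log (3 / 2))
  let sw : (ι → Bool) → (ι ⊕ ι → 𝒳) → (ι ⊕ ι → 𝒳) := fun σ z => z ∘ swapIdx σ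
  have hmp : ∀ σ, MeasurePreserving (sw σ) Q Q := fun σ =>
    measurePreserving_comp_equiv P (swapIdx_involutive σ).toPerm
  have hB := nullMeasurableSet_ghostEvent hC hg ι τ s
  have hBσ : ∀ σ, NullMeasurableSet (sw σ ⁻¹' B) Q := fun σ =>
    hB.preimage (hmp σ).quasiMeasurePreserving
  have hpt : ∀ z, (({σ | sw σ z ∈ B}.ncard : ℕ) : ℝ) ≤ S * (2 ^ Fintype.card ι * w) := by
    intro z
    have hfin : (patterns C z).Finite := Set.toFinite _
    let E : (ι ⊕ ι → Bool) → Set (ι → Bool) := fun a =>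
      {σ | (countL ((fun i => a i != g (z i)) ∘ swapIdx σ) : ℝ) ≤ τ ∧
        s ≤ countR ((fun i => a i != g (z i)) ∘ swapIdx σ)}
    have hsub : {σ | sw σ z ∈ B} ⊆ ⋃ a ∈ hfin.toFinset, E a := by
      rintro σ ⟨a, ⟨h, hC, ha⟩, h1, h2⟩
      have ha' : (fun i => a i != g (sw σ z i)) =
          (fun i => h (z i) != g (z i)) ∘ swapIdx σ := by
        funext i
        simp only [Function.comp, ← ha, sw]
      rw [ha'] at h1 h2
      simp only [Set.mem_iUnion, Set.Finite.mem_toFinset]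
      exact ⟨fun i => h (z i), ⟨h, hC, fun i => rfl⟩, h1, h2⟩
    calc (({σ | sw σ z ∈ B}.ncard : ℕ) : ℝ)
        ≤ ((⋃ a ∈ hfin.toFinset, E a).ncard : ℕ) := by
          exact_mod_cast Set.ncard_le_ncard hsub (Set.toFinite _)
      _ ≤ ∑ a ∈ hfin.toFinset, ((E a).ncard : ℝ) := by
          exact_mod_cast Finset.set_ncard_biUnion_le _ _
      _ ≤ ∑ _a ∈ hfin.toFinset, 2 ^ Fintype.card ι * w :=
          Finset.sum_le_sum fun a _ => card_swaps_le _ τ s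
      _ = (patterns C z).ncard * (2 ^ Fintype.card ι * w) := by
          rw [Finset.sum_const, nsmul_eq_mul, Set.ncard_eq_toFinset_card _ hfin]
      _ ≤ S * (2 ^ Fintype.card ι * w) := by
          gcongr
          exact ncard_patterns_le hd hd1 hn z
  have hcard : (Fintype.card (ι → Bool) : ℝ≥0∞) = ENNReal.ofReal (2 ^ Fintype.card ι) := by
    rw [Fintype.card_fun, Fintype.card_bool, ENNReal.ofReal_pow (by norm_num)]
    simp
  have hsum : ENNReal.ofReal (2 ^ Fintype.card ι) * Q B ≤
      ENNReal.ofReal (2 ^ Fintype.card ι) * ENNReal.ofReal (S * w) := by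
    calc ENNReal.ofReal (2 ^ Fintype.card ι) * Q B
        = ∑ σ : ι → Bool, Q (sw σ ⁻¹' B) := by
          rw [Finset.sum_congr rfl fun σ _ => (hmp σ).measure_preimage hB,
            Finset.sum_const, Finset.card_univ, nsmul_eq_mul, hcard]
      _ = ∑ σ : ι → Bool, ∫⁻ z, (sw σ ⁻¹' B).indicator (fun _ => (1 : ℝ≥0∞)) z ∂Q := by
          refine Finset.sum_congr rfl fun σ _ => ?_
          exact (lintegral_indicator_one₀ (hBσ σ)).symm
      _ = ∫⁻ z, ∑ σ : ι → Bool, (sw σ ⁻¹' B).indicator (fun _ => (1 : ℝ≥0∞)) z ∂Q := by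
          rw [lintegral_finsetSum' _ fun σ _ => aemeasurable_const.indicator₀ (hBσ σ)]
      _ ≤ ∫⁻ _z, ENNReal.ofReal (S * (2 ^ Fintype.card ι * w)) ∂Q := by
          refine lintegral_mono fun z => ?_
          have : ∑ σ : ι → Bool, (sw σ ⁻¹' B).indicator (fun _ => (1 : ℝ≥0∞)) z =
              (({σ | sw σ z ∈ B}.ncard : ℕ) : ℝ≥0∞) := by
            rw [Set.ncard_eq_toFinset_card']
            simp [Set.indicator_apply]
          rw [this, ← ENNReal.ofReal_natCast]
          exact ENNReal.ofReal_le_ofReal (hpt z)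
      _ = ENNReal.ofReal (2 ^ Fintype.card ι) * ENNReal.ofReal (S * w) := by
          rw [lintegral_const, measure_univ, mul_one, ← ENNReal.ofReal_mul (by positivity)]
          congr 1; ring
  rw [ENNReal.mul_le_mul_iff_right (by simp) ENNReal.ofReal_ne_top] at hsum
  rwa [Real.exp_add]

/-- With high probability every concept at distance more than `r` from `g` disagrees with `g` on
more than `τ` of `m` sample points. The ghost sample supplies the lower bound `r m / 2` for the
number of disagreements on the second half of a double sample. -/
lemma measure_exists_far_of_few_le {C : Set (𝒳 → Bool)} (hC : MeasurableClass P C) {d : ℕ}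
    (hd : vcDim C ≤ d) (hd1 : 1 ≤ d) {g : 𝒳 → Bool} (hg : g ∈ C) {m : ℕ} (hn : d ≤ 2 * m)
    {r : ℝ} (hr : 5 ≤ r * m) (τ : ℝ) :
    (Measure.pi fun _ : Fin m => P) {x | ∃ h ∈ C, r < disagreement P h g ∧
        ((Finset.univ.filter fun i => h (x i) ≠ g (x i)).card : ℝ) ≤ τ} ≤
      ENNReal.ofReal (2 * Real.exp (d * (1 + Real.log (2 * m / d)) +
        (τ * Real.log 2 - r * m / 2 * Real.log (3 / 2)))) := by
  classical
  set Q : Measure (Fin m ⊕ Fin m → 𝒳) := Measure.pi fun _ => P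
  set ν : Measure (Fin m → 𝒳) := Measure.pi fun _ => P
  set F : Set (Fin m → 𝒳) := {x | ∃ h ∈ C, r < disagreement P h g ∧
        ((Finset.univ.filter fun i => h (x i) ≠ g (x i)).card : ℝ) ≤ τ}
  have hgm := hC.measurable g hg
  have hcard : Fintype.card (Fin m ⊕ Fin m) = 2 * m := by simp [two_mul]
  have hup := measure_ghostEvent_le hC hd hd1 hgm (Fin m) (by rw [hcard]; exact hn) τ (r * m / 2)
  rw [hcard] at hup
  set B := ghostEvent C g (Fin m) τ (r * m / 2)
  set T := toMeasurable Q B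
  have hT : MeasurableSet T := measurableSet_toMeasurable _ _
  have hmp := measurePreserving_sumElim P (ι := Fin m) (κ := Fin m)
  set φ : (Fin m → 𝒳) × (Fin m → 𝒳) → (Fin m ⊕ Fin m → 𝒳) := fun z => Sum.elim z.1 z.2
  have hT' : MeasurableSet (φ ⁻¹' T) := hmp.measurable hT
  have hQ : Q B = ∫⁻ x, ν (Prod.mk x ⁻¹' (φ ⁻¹' T)) ∂ν := by
    rw [← measure_toMeasurable, ← hmp.measure_preimage hT.nullMeasurableSet,
      Measure.prod_apply hT']
  have hhalf : ∀ x ∈ F, (1 / 2 : ℝ≥0∞) ≤ ν (Prod.mk x ⁻¹' (φ ⁻¹' T)) := by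
    rintro x ⟨h, hhC, hfar, hfew⟩
    have hset : {x' : Fin m → 𝒳 | r * m / 2 ≤
        (Finset.univ.filter fun i => x' i ∈ {x | h x ≠ g x}).card} ⊆
        Prod.mk x ⁻¹' (φ ⁻¹' T) := by
      intro x' hx'
      refine subset_toMeasurable Q B ?_
      refine ⟨fun i => h (φ (x, x') i), ⟨h, hhC, fun i => rfl⟩, ?_, ?_⟩
      · simpa [countL, φ] using hfew
      · simpa [countR, φ] using hx'
    refine le_trans ?_ (measure_mono hset)
    have hmeas : MeasurableSet {x | h x ≠ g x} :=
      (measurableSet_eq_fun (hC.measurable h hhC) hgm).compl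
    have hlow := measure_count_le P (A := fun _ : Fin m => {x | h x ≠ g x}) (fun _ => hmeas)
      (-Real.log 2) (-(r * m / 2 * Real.log 2))
    have hl2 : 0 < Real.log 2 := Real.log_pos (by norm_num)
    have hl2' := Real.log_two_lt_d9
    have hexp : Real.exp (-Real.log 2) = 1 / 2 := by
      rw [Real.exp_neg, Real.exp_log (by norm_num)]; norm_num
    have hsmall : Real.exp ((Real.exp (-Real.log 2) - 1) *
        ∑ _i : Fin m, P.real {x | h x ≠ g x} - -(r * m / 2 * Real.log 2)) ≤ 1 / 2 := by
      rw [← hexp]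
      refine Real.exp_le_exp.2 ?_
      rw [hexp, Finset.sum_const, Finset.card_univ, Fintype.card_fin, nsmul_eq_mul]
      have h1 : r * m ≤ m * P.real {x | h x ≠ g x} := by
        rw [mul_comm]
        exact mul_le_mul_of_nonneg_left hfar.le (by positivity)
      nlinarith
    have hU : (1 : ℝ≥0∞) ≤ ν {x' : Fin m → 𝒳 | r * m / 2 ≤
        (Finset.univ.filter fun i => x' i ∈ {x | h x ≠ g x}).card} + 1 / 2 := by
      have hhalf' : ν {x : Fin m → 𝒳 | -(r * m / 2 * Real.log 2) ≤
          -Real.log 2 * (Finset.univ.filter fun i => x i ∈ {x | h x ≠ g x}).card} ≤ 1 / 2 := by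
        have := hlow.trans hsmall
        rw [measureReal_def, ← ENNReal.le_ofReal_iff_toReal_le (measure_ne_top _ _)
          (by norm_num)] at this
        rw [ENNReal.ofReal_div_of_pos (by norm_num)] at this
        simpa using this
      refine (measure_univ (μ := ν)).symm.le.trans ?_
      refine (measure_mono (μ := ν) ?_).trans ((measure_union_le _ _).trans
        (add_le_add_right hhalf' _))
      intro x' _
      rcases le_total (r * m / 2)
        ((Finset.univ.filter fun i => x' i ∈ {x | h x ≠ g x}).card : ℝ) with h1 | h1
      · exact Or.inl h1
      · refine Or.inr ?_
        have := mul_le_mul_of_nonneg_right h1 hl2.le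
        simp only [Set.mem_ofPred_eq]
        simp only [Set.mem_ofPred_eq] at this
        linarith
    by_contra hlt
    rw [not_le] at hlt
    have h2 := ENNReal.add_lt_add_right (by simp : (1 / 2 : ℝ≥0∞) ≠ ⊤) hlt
    rw [ENNReal.add_halves] at h2
    exact absurd (hU.trans_lt h2) (lt_irrefl _)
  have hmeas : Measurable fun x => ν (Prod.mk x ⁻¹' (φ ⁻¹' T)) := measurable_measure_prodMk_left hT'
  have hF : ν F ≤ 2 * Q B := by
    have hM := mul_meas_ge_le_lintegral (μ := ν) hmeas (1 / 2)
    rw [← hQ] at hM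
    have h2 : (1 / 2 : ℝ≥0∞) * ν F ≤ Q B := by
      refine le_trans ?_ hM
      gcongr
      exact hhalf
    calc ν F = 2 * ((1 / 2) * ν F) := by
          rw [← mul_assoc, one_div, ENNReal.mul_inv_cancel (by simp) (by simp), one_mul]
      _ ≤ 2 * Q B := by gcongr
  refine hF.trans ?_
  rw [ENNReal.ofReal_mul (by norm_num)]
  push_cast at hup
  simpa using mul_le_mul_right hup 2

end Deviation

/-! ### Survivors of a typical batch -/

section Algorithm

variable {𝒳 : Type*}

lemma mem_versionSpace_iff {C : Set (𝒳 → Bool)} {thr : ℕ → ℝ} {x : ℕ → 𝒳} {y : ℕ → Bool}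
    {g : ℕ → 𝒳 → Bool} {k : ℕ} {h : 𝒳 → Bool} :
    h ∈ versionSpace C thr x y g k ↔ h ∈ C ∧ ∀ j < k,
      (queriedErrors x y (versionSpace C thr x y g j) j h : ℝ)
        - queriedErrors x y (versionSpace C thr x y g j) j (g (j + 1)) ≤ thr j := by
  induction k with
  | zero => simp [versionSpace]
  | succ k ih =>
    simp only [versionSpace, Set.mem_ofPred_eq, ih, Nat.lt_succ_iff_lt_or_eq, or_imp, forall_and,
      forall_eq, and_assoc]

lemma versionSpace_subset {C : Set (𝒳 → Bool)} {thr : ℕ → ℝ} {x : ℕ → 𝒳} {y : ℕ → Bool}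
    {g : ℕ → 𝒳 → Bool} {k : ℕ} : versionSpace C thr x y g k ⊆ C :=
  fun _ hh => (mem_versionSpace_iff.1 hh).1

lemma DIS_mono {H H' : Set (𝒳 → Bool)} (h : H ⊆ H') : DIS H ⊆ DIS H' := by
  rintro x ⟨f, hf, g, hg, hne⟩
  exact ⟨f, h hf, g, h hg, hne⟩

lemma queriedErrors_congr {x x' : ℕ → 𝒳} {y y' : ℕ → Bool} {V V' : Set (𝒳 → Bool)} {k : ℕ}
    {h h' : 𝒳 → Bool} (hV : ∀ p ∈ Finset.Ico (2 ^ k) (2 ^ (k + 1)), x p ∈ DIS V ↔ x' p ∈ DIS V')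
    (hh : ∀ p ∈ Finset.Ico (2 ^ k) (2 ^ (k + 1)), h (x p) = h' (x' p))
    (hy : ∀ p ∈ Finset.Ico (2 ^ k) (2 ^ (k + 1)), y p = y' p) :
    queriedErrors x y V k h = queriedErrors x' y' V' k h' := by
  classical
  unfold queriedErrors
  congr 1
  refine Finset.filter_congr fun p hp => ?_
  rw [hV p hp, hh p hp, hy p hp]

open Classical in
/-- The deterministic core of the analysis. As long as a reference concept `h₀` makes at most
`thr j` mistakes on each block `j < k`, and concepts with at most `3 * thr j` disagreements with
`h₀` on block `j` are within distance `r j` of `h₀`, the reference concept survives, and after the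
last block all survivors, among them the current classifier, are close to it. -/
lemma versionSpace_good [MeasurableSpace 𝒳] {P : Measure 𝒳} {C : Set (𝒳 → Bool)} {thr r : ℕ → ℝ}
    {x : ℕ → 𝒳} {y : ℕ → Bool} {g : ℕ → 𝒳 → Bool} {h₀ : 𝒳 → Bool} (h₀C : h₀ ∈ C) {k : ℕ}
    (hmin : ∀ j < k, (versionSpace C thr x y g j).Nonempty →
      g (j + 1) ∈ versionSpace C thr x y g j ∧ ∀ h ∈ versionSpace C thr x y g j,
        queriedErrors x y (versionSpace C thr x y g j) j (g (j + 1)) ≤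
          queriedErrors x y (versionSpace C thr x y g j) j h)
    (hA : ∀ j < k, (((Finset.Ico (2 ^ j) (2 ^ (j + 1))).filter fun p => h₀ (x p) ≠ y p).card : ℝ)
      ≤ thr j)
    (hB : ∀ j < k, ∀ h ∈ C,
      (((Finset.Ico (2 ^ j) (2 ^ (j + 1))).filter fun p => h (x p) ≠ h₀ (x p)).card : ℝ)
        ≤ 3 * thr j → disagreement P h h₀ ≤ r j) :
    h₀ ∈ versionSpace C thr x y g k ∧ ∀ j, j + 1 = k →
      g k ∈ versionSpace C thr x y g k ∧
        ∀ h ∈ versionSpace C thr x y g k, disagreement P h h₀ ≤ r j := by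
  have hq0 : ∀ V j, queriedErrors x y V j h₀ ≤
      ((Finset.Ico (2 ^ j) (2 ^ (j + 1))).filter fun p => h₀ (x p) ≠ y p).card := by
    intro V j
    refine Finset.card_le_card fun p hp => ?_
    simp only [Finset.mem_filter] at hp ⊢
    exact ⟨hp.1, hp.2.2⟩
  have hmem : ∀ i ≤ k, h₀ ∈ versionSpace C thr x y g i := by
    intro i hi
    refine mem_versionSpace_iff.2 ⟨h₀C, fun j hj => ?_⟩
    have h1 : (queriedErrors x y (versionSpace C thr x y g j) j h₀ : ℝ) ≤ thr j :=
      le_trans (by exact_mod_cast hq0 _ j) (hA j (hj.trans_le hi))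
    have h2 : (0 : ℝ) ≤ queriedErrors x y (versionSpace C thr x y g j) j (g (j + 1)) :=
      Nat.cast_nonneg _
    linarith
  refine ⟨hmem k le_rfl, ?_⟩
  rintro j rfl
  have hj : j < j + 1 := Nat.lt_succ_self j
  have h₀V := hmem j hj.le
  obtain ⟨hgV, hgmin⟩ := hmin j hj ⟨h₀, h₀V⟩
  have h₀q : (queriedErrors x y (versionSpace C thr x y g j) j h₀ : ℝ) ≤ thr j :=
    le_trans (by exact_mod_cast hq0 _ j) (hA j hj)
  have hthr : 0 ≤ thr j := le_trans (Nat.cast_nonneg _) (hA j hj)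
  refine ⟨⟨hgV, by simpa using hthr⟩, ?_⟩
  rintro h ⟨hV, hex⟩
  refine hB j hj h (versionSpace_subset hV) ?_
  -- a disagreement of two members of `V_j` lies in `DIS V_j`, and one of the two errs there
  have hsub : (Finset.Ico (2 ^ j) (2 ^ (j + 1))).filter (fun p => h (x p) ≠ h₀ (x p)) ⊆
      ((Finset.Ico (2 ^ j) (2 ^ (j + 1))).filter
        fun p => x p ∈ DIS (versionSpace C thr x y g j) ∧ h (x p) ≠ y p) ∪
      ((Finset.Ico (2 ^ j) (2 ^ (j + 1))).filter
        fun p => x p ∈ DIS (versionSpace C thr x y g j) ∧ h₀ (x p) ≠ y p) := by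
    intro p hp
    simp only [Finset.mem_filter, Finset.mem_union] at hp ⊢
    have hD : x p ∈ DIS (versionSpace C thr x y g j) := ⟨h, hV, h₀, h₀V, hp.2⟩
    by_cases hy : h (x p) = y p
    · exact Or.inr ⟨hp.1, hD, fun h' => hp.2 (hy.trans h'.symm)⟩
    · exact Or.inl ⟨hp.1, hD, hy⟩
  have hle : (((Finset.Ico (2 ^ j) (2 ^ (j + 1))).filter fun p => h (x p) ≠ h₀ (x p)).card : ℝ) ≤
      queriedErrors x y (versionSpace C thr x y g j) j h +
        queriedErrors x y (versionSpace C thr x y g j) j h₀ := by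
    exact_mod_cast (Finset.card_le_card hsub).trans (Finset.card_union_le _ _)
  have hg0 : (queriedErrors x y (versionSpace C thr x y g j) j (g (j + 1)) : ℝ) ≤
      queriedErrors x y (versionSpace C thr x y g j) j h₀ := by exact_mod_cast hgmin h₀ h₀V
  linarith

end Algorithm

/-! ### Samples along a filtration -/

section Sampling

variable {𝒳 Ω : Type*} [MeasurableSpace 𝒳] {P : Measure 𝒳}
  {mΩ : MeasurableSpace Ω} {μ : Measure Ω}
  {ℱ : Filtration ℕ mΩ} {X : ℕ → Ω → 𝒳}

/-- `X` is a sample from `P` along the filtration `ℱ`: every `X n` has law `P`, is independent of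
the information `ℱ n` available before instance `n`, and belongs to `ℱ (n + 1)`. -/
structure IsAdaptedSample (P : Measure 𝒳) (μ : Measure Ω) (ℱ : Filtration ℕ mΩ)
    (X : ℕ → Ω → 𝒳) : Prop where
  adapted : ∀ n, Measurable[ℱ (n + 1)] (X n)
  indep : ∀ n, Indep (MeasurableSpace.comap (X n) inferInstance) (ℱ n) μ
  law : ∀ n, μ.map (X n) = P

lemma IsAdaptedSample.measurable (hS : IsAdaptedSample P μ ℱ X) (n : ℕ) : Measurable (X n) :=
  (hS.adapted n).mono (ℱ.le _) le_rfl

lemma IsAdaptedSample.iIndepFun [IsProbabilityMeasure μ] (hS : IsAdaptedSample P μ ℱ X) :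
    iIndepFun X μ := by
  classical
  rw [iIndepFun_iff_measure_inter_preimage_eq_mul]
  intro S
  induction S using Finset.induction_on_max with
  | empty => intro sets _; simp
  | insert n S hlt ih =>
    intro sets hsets
    have hn : n ∉ S := fun h => lt_irrefl _ (hlt n h)
    have hmeas : MeasurableSet[ℱ n] (⋂ i ∈ S, X i ⁻¹' sets i) := by
      refine MeasurableSet.biInter (Set.to_countable _) fun i hi => ?_
      exact ℱ.mono (hlt i hi) _ (hS.adapted i (hsets i (Finset.mem_insert_of_mem hi)))
    rw [Finset.set_biInter_insert, Finset.prod_insert hn,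
      ← ih fun i hi => hsets i (Finset.mem_insert_of_mem hi)]
    exact (Indep_iff _ _ _).1 (hS.indep n) _ _ ⟨_, hsets n (Finset.mem_insert_self _ _), rfl⟩ hmeas

lemma IsAdaptedSample.measurePreserving_sample [IsProbabilityMeasure μ]
    (hS : IsAdaptedSample P μ ℱ X) {ι : Type*} [Fintype ι] {f : ι → ℕ}
    (hf : Function.Injective f) :
    MeasurePreserving (fun ω i => X (f i) ω) μ (Measure.pi fun _ : ι => P) := by
  have hXm : ∀ n, Measurable (X n) := hS.measurable
  refine ⟨measurable_pi_lambda _ fun i => hXm _, ?_⟩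
  have h := (iIndepFun_iff_map_fun_eq_pi_map fun i => (hXm (f i)).aemeasurable).1
    (hS.iIndepFun.precomp hf)
  rw [h]
  simp_rw [hS.law]

/-- If every section of an event about an independent pair has probability at most `c`, then so
has the event. -/
lemma measure_pair_le [IsProbabilityMeasure μ] {Ω' : Type*} {m' : MeasurableSpace Ω'}
    {f : Ω → Ω'} {Y : Ω → 𝒳}
    (hf : Measurable f) (hY : Measurable Y) (hind : IndepFun f Y μ) (hlaw : μ.map Y = P)
    {D : Set (Ω' × 𝒳)} (hD : MeasurableSet D) {c : ℝ≥0∞} (hc : ∀ a, P (Prod.mk a ⁻¹' D) ≤ c) :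
    μ {ω | (f ω, Y ω) ∈ D} ≤ c := by
  have h := (indepFun_iff_map_prod_eq_prod_map_map hf.aemeasurable hY.aemeasurable).1 hind
  have := Measure.isProbabilityMeasure_map (μ := μ) hf.aemeasurable
  have h2 : μ {ω | (f ω, Y ω) ∈ D} = ∫⁻ a, P (Prod.mk a ⁻¹' D) ∂(μ.map f) := by
    rw [← hlaw, ← Measure.prod_apply hD, ← h, Measure.map_apply (hf.prodMk hY) hD]
    rfl
  rw [h2]
  refine (lintegral_mono fun a => hc a).trans ?_
  simp

lemma IsAdaptedSample.measure_section_le [IsProbabilityMeasure μ]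
    (hS : IsAdaptedSample P μ ℱ X) {n : ℕ} {D : Set (Ω × 𝒳)}
    (hD : MeasurableSet[(ℱ n).prod inferInstance] D) {c : ℝ≥0∞}
    (hc : ∀ ω, P (Prod.mk ω ⁻¹' D) ≤ c) : μ {ω | (ω, X n ω) ∈ D} ≤ c := by
  refine measure_pair_le (m' := ℱ n) (f := id) (fun s hs => ℱ.le n s hs)
    (hS.measurable n) ?_ (hS.law n) hD hc
  refine (@IndepFun_iff_Indep Ω Ω 𝒳 mΩ (ℱ n) _ id (X n) μ).2 ?_
  rw [MeasurableSpace.comap_id]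
  exact (hS.indep n).symm

lemma IsAdaptedSample.measure_past_inter_le (hS : IsAdaptedSample P μ ℱ X) {n : ℕ} {F : Set Ω}
    (hF : MeasurableSet[ℱ n] F) (A : Set 𝒳) :
    μ (F ∩ X n ⁻¹' A) ≤ μ F * P A := by
  have hXm : Measurable (X n) := hS.measurable n
  calc μ (F ∩ X n ⁻¹' A) ≤ μ (X n ⁻¹' toMeasurable P A ∩ F) := by
        refine measure_mono fun ω hω => ⟨subset_toMeasurable P A hω.2, hω.1⟩
    _ = μ (X n ⁻¹' toMeasurable P A) * μ F :=
        (Indep_iff _ _ _).1 (hS.indep n) _ _ ⟨_, measurableSet_toMeasurable _ _, rfl⟩ hF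
    _ = μ F * P A := by
        rw [← Measure.map_apply hXm (measurableSet_toMeasurable _ _), hS.law, measure_toMeasurable,
          mul_comm]

lemma IsAdaptedSample.measure_preimage_le (hS : IsAdaptedSample P μ ℱ X) (n : ℕ) (A : Set 𝒳) :
    μ (X n ⁻¹' A) ≤ P A := by
  rw [← hS.law n]
  exact Measure.le_map_apply (hS.measurable n).aemeasurable A

end Sampling

/-! ### Measurability of the queries -/

section Measurability

variable {𝒳 Ω : Type*} [MeasurableSpace 𝒳] {P : Measure 𝒳} [IsProbabilityMeasure P]
  {mΩ : MeasurableSpace Ω} {μ : Measure Ω} [IsProbabilityMeasure μ]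
  {ℱ : Filtration ℕ mΩ} {X : ℕ → Ω → 𝒳}

/-- Whether a point is queried depends only on the labellings of the data so far that are realised
by concepts, on the target labels, on the predictions of the classifiers and on the earlier
queries. -/
lemma nullMeasurableSet_query {C : Set (𝒳 → Bool)} (hC : MeasurableClass P C) {thr : ℕ → ℝ}
    {M : ℕ} {hs : ℕ → 𝒳 → Bool} {hhat : ℕ → ℕ → Ω → 𝒳 → Bool} {i : ℕ}
    (hS : IsAdaptedSample P μ ℱ X)
    (hy : ∀ n, Measurable fun ω => hs n (X n ω))
    (hhm : ∀ k, 2 ^ (k + 1) ≤ M → ∀ n, Measurable fun ω => hhat i (k + 1) ω (X n ω))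
    (k : ℕ) (hk : 2 ^ k ≤ M) (n : ℕ) :
    NullMeasurableSet {ω | X n ω ∈ DIS (batchVersionSpace C thr M hs X hhat i k ω)} μ := by
  induction k using Nat.strong_induction_on generalizing n with
  | h k ih =>
  set N := n + M * i + 2 ^ k + 1 with hN
  have hpowM : ∀ j < k, 2 ^ (j + 1) ≤ M := fun j hj =>
    (Nat.pow_le_pow_right (by norm_num) hj).trans hk
  have hpowM' : ∀ j < k, 2 ^ j ≤ M := fun j hj =>
    (Nat.pow_le_pow_right (by norm_num) hj.le).trans hk
  refine nullMeasurableSet_of_determined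
    (κ := (Fin N → Bool) ⊕ (Fin k × Fin N) ⊕ Fin N ⊕ (Fin k × Fin N))
    (p := Sum.elim (fun a ω => a ∈ patterns C fun q : Fin N => X q ω)
      (Sum.elim (fun jq ω => X jq.2 ω ∈ DIS (batchVersionSpace C thr M hs X hhat i jq.1 ω))
      (Sum.elim (fun q ω => hs q (X q ω) = true)
        (fun jq ω => hhat i (jq.1 + 1) ω (X jq.2 ω) = true)))) ?_ ?_
  · rintro (a | ⟨j, q⟩ | q | ⟨j, q⟩)
    · exact (nullMeasurableSet_patterns hC a).preimage
        (hS.measurePreserving_sample Fin.val_injective).quasiMeasurePreserving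
    · exact ih j j.2 (hpowM' j j.2) q
    · exact (hy q (measurableSet_singleton true)).nullMeasurableSet
    · exact (hhm j (hpowM j j.2) q (measurableSet_singleton true)).nullMeasurableSet
  · intro ω ω' hag hω
    have hpos : ∀ j < k, ∀ p ∈ Finset.Ico (2 ^ j) (2 ^ (j + 1)), M * i + p < N := by
      intro j hj p hp
      have h1 := (Finset.mem_Ico.1 hp).2
      have h2 : 2 ^ (j + 1) ≤ 2 ^ k := Nat.pow_le_pow_right (by norm_num) hj
      omega
    have transfer : ∀ h ∈ batchVersionSpace C thr M hs X hhat i k ω,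
        ∃ h' ∈ batchVersionSpace C thr M hs X hhat i k ω', ∀ q < N, h' (X q ω') = h (X q ω) := by
      intro h hh
      obtain ⟨hhC, hh⟩ := mem_versionSpace_iff.1 hh
      obtain ⟨h', h'C, hh'⟩ := (hag (.inl fun q => h (X q ω))).1 ⟨h, hhC, fun q => rfl⟩
      refine ⟨h', mem_versionSpace_iff.2 ⟨h'C, fun j hj => ?_⟩, fun q hq => hh' ⟨q, hq⟩⟩
      have hD : ∀ p ∈ Finset.Ico (2 ^ j) (2 ^ (j + 1)),
          X (M * i + p) ω' ∈ DIS (batchVersionSpace C thr M hs X hhat i j ω') ↔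
          X (M * i + p) ω ∈ DIS (batchVersionSpace C thr M hs X hhat i j ω) := fun p hp =>
        (hag (.inr (.inl (⟨j, hj⟩, ⟨M * i + p, hpos j hj p hp⟩)))).symm
      have hY : ∀ p ∈ Finset.Ico (2 ^ j) (2 ^ (j + 1)),
          hs (M * i + p) (X (M * i + p) ω') = hs (M * i + p) (X (M * i + p) ω) := fun p hp =>
        Bool.eq_iff_iff.2 (hag (.inr (.inr (.inl ⟨M * i + p, hpos j hj p hp⟩)))).symm
      have hG : ∀ p ∈ Finset.Ico (2 ^ j) (2 ^ (j + 1)),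
          hhat i (j + 1) ω' (X (M * i + p) ω') = hhat i (j + 1) ω (X (M * i + p) ω) := fun p hp =>
        Bool.eq_iff_iff.2
          (hag (.inr (.inr (.inr (⟨j, hj⟩, ⟨M * i + p, hpos j hj p hp⟩))))).symm
      have hH : ∀ p ∈ Finset.Ico (2 ^ j) (2 ^ (j + 1)),
          h' (X (M * i + p) ω') = h (X (M * i + p) ω) := fun p hp =>
        hh' ⟨M * i + p, hpos j hj p hp⟩
      have e1 := queriedErrors_congr (x := fun p => X (M * i + p) ω')
        (x' := fun p => X (M * i + p) ω) hD hH hY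
      have e2 := queriedErrors_congr (x := fun p => X (M * i + p) ω')
        (x' := fun p => X (M * i + p) ω) hD hG hY
      have := hh j hj
      unfold batchVersionSpace at e1 e2
      rw [e1, e2]
      exact this
    obtain ⟨f, hf, g, hg, hne⟩ := hω
    obtain ⟨f', hf', hff⟩ := transfer f hf
    obtain ⟨g', hg', hgg⟩ := transfer g hg
    refine ⟨f', hf', g', hg', ?_⟩
    have hnN : n < N := Nat.lt_succ_of_le ((Nat.le_add_right _ _).trans (Nat.le_add_right _ _))
    rw [hff n hnN, hgg n hnN]
    exact hne

end Measurability

/-! ### Thresholds and exponents -/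

section Log

lemma one_le_Log (x : ℝ) : 1 ≤ Log x := by
  rw [Log, Real.le_log_iff_exp_le (lt_max_of_lt_right (Real.exp_pos 1))]
  exact le_max_right _ _

lemma log_le_Log {x : ℝ} (hx : 0 < x) : Real.log x ≤ Log x :=
  Real.log_le_log hx (le_max_left _ _)

end Log

section Numeric

/-- The distance to the first target of a batch within which all survivors of block `j` lie. -/
noncomputable def survivorRadius (d : ℕ) (Δ : ℝ) (j : ℕ) : ℝ :=
  200 * d * Log (1 / (d * Δ)) / 2 ^ j

variable {d : ℕ} {Δ : ℝ}

lemma threshold_eq (hd : 1 ≤ d) (hΔ : 0 < Δ) (j : ℕ) :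
    threshold d Δ j * Real.log 2 = Real.log (1 / (d * Δ)) / 2 +
      4 * ((2 ^ j) ^ 2 * Δ) * (Real.exp 1 * Real.log 2) := by
  have hd0 : (0 : ℝ) < d := by exact_mod_cast hd
  have hl2 : Real.log 2 ≠ 0 := (Real.log_pos (by norm_num)).ne'
  rw [threshold, Real.logb, one_div, one_div, Real.log_inv, Real.log_inv,
    Real.log_sqrt (by positivity), add_mul, div_mul_cancel₀ _ hl2,
    show (2 : ℝ) ^ (2 * j + 2) = 4 * (2 ^ j) ^ 2 by ring]
  ring

/-- The Chernoff exponent for the mistakes of the first target of a batch in block `j`. -/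
lemma chernoff_exponent_le (hd : 1 ≤ d) (hΔ : 0 < Δ) (j : ℕ) :
    Real.exp (2 ^ j * (2 ^ (j + 1) * Δ) - threshold d Δ j * Real.log 2) ≤ √(d * Δ) := by
  have hd0 : (0 : ℝ) < d := by exact_mod_cast hd
  have hx : 0 < d * Δ := by positivity
  have h1 : (1 : ℝ) / 2 ≤ Real.exp 1 * Real.log 2 := by
    have := Real.exp_one_gt_d9
    have := Real.log_two_gt_d9
    nlinarith
  rw [threshold_eq hd hΔ, ← Real.exp_log (Real.sqrt_pos.2 hx), Real.log_sqrt hx.le,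
    Real.exp_le_exp, one_div, Real.log_inv]
  have h2 : 0 < ((2 : ℝ) ^ j) ^ 2 * Δ := by positivity
  have h3 : (2 : ℝ) ^ j * (2 ^ (j + 1) * Δ) = 2 * ((2 ^ j) ^ 2 * Δ) := by ring
  rw [h3]
  nlinarith [mul_le_mul_of_nonneg_left h1 h2.le]

/-- The deviation exponent: the term `200 / 2 * log (3 / 2)` from the ghost sample outweighs the
number of patterns and the threshold. -/
lemma deviation_exponent_le (hd : 1 ≤ d) (hΔ : 0 < Δ) {j : ℕ}
    (hj : ((2 : ℝ) ^ j) ^ 2 * Δ ≤ d) :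
    2 * Real.exp (d * (1 + Real.log (2 * 2 ^ j / d)) + (3 * threshold d Δ j * Real.log 2 -
      survivorRadius d Δ j * 2 ^ j / 2 * Real.log (3 / 2))) ≤ √(d * Δ) := by
  have hd0 : (0 : ℝ) < d := by exact_mod_cast hd
  have hd1 : (1 : ℝ) ≤ d := by exact_mod_cast hd
  have hx : 0 < d * Δ := by positivity
  have hm : (0 : ℝ) < 2 ^ j := by positivity
  set L := Log (1 / (d * Δ)) with hLdef
  have hL1 : 1 ≤ L := one_le_Log _
  have hLx : Real.log (1 / (d * Δ)) ≤ L := log_le_Log (by positivity)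
  have hl2 := Real.log_two_lt_d9
  have hl2' := Real.log_two_gt_d9
  have he := Real.exp_one_lt_d9
  have hl3 : (1 : ℝ) / 3 ≤ Real.log (3 / 2) := by
    have := Real.one_sub_inv_le_log_of_pos (show (0 : ℝ) < 3 / 2 by norm_num)
    norm_num at this ⊢
    linarith
  have hlog : Real.log (2 * 2 ^ j / d) ≤ Real.log 2 + L / 2 := by
    have h1 : Real.log (((2 : ℝ) ^ j / d) ^ 2) ≤ Real.log (1 / (d * Δ)) := by
      refine Real.log_le_log (by positivity) ?_
      rw [div_pow, div_le_div_iff₀ (by positivity) hx]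
      nlinarith
    rw [Real.log_pow] at h1
    rw [mul_div_assoc, Real.log_mul (by norm_num) (by positivity)]
    push_cast at h1
    linarith
  have hsr : survivorRadius d Δ j * 2 ^ j / 2 = 100 * (d * L) := by
    rw [survivorRadius, div_mul_cancel₀ _ hm.ne']; ring
  have hdL : (d : ℝ) ≤ d * L := by nlinarith
  have hLdL : L ≤ d * L := by nlinarith
  have hthr : 3 * threshold d Δ j * Real.log 2 ≤ 3 / 2 * L + 24 * d := by
    rw [mul_assoc, threshold_eq hd hΔ]
    have h1 : Real.exp 1 * Real.log 2 ≤ 2 := by nlinarith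
    have h2 : (2 ^ j) ^ 2 * Δ * (Real.exp 1 * Real.log 2) ≤ d * 2 :=
      mul_le_mul hj h1 (by positivity) hd0.le
    nlinarith
  rw [hsr]
  have h2 : (2 : ℝ) = Real.exp (Real.log 2) := (Real.exp_log (by norm_num)).symm
  have hneg : -(L / 2) ≤ Real.log (d * Δ) / 2 := by
    rw [one_div, Real.log_inv] at hLx; linarith
  calc _ = Real.exp (Real.log 2 + (d * (1 + Real.log (2 * 2 ^ j / d)) +
        (3 * threshold d Δ j * Real.log 2 - 100 * (d * L) * Real.log (3 / 2)))) := by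
        rw [Real.exp_add (Real.log 2), Real.exp_log (by norm_num)]
    _ ≤ Real.exp (Real.log (d * Δ) / 2) := by
        refine Real.exp_le_exp.2 ?_
        have h4 : d * (1 + Real.log (2 * 2 ^ j / d)) ≤ d * (1.7 + L / 2) :=
          mul_le_mul_of_nonneg_left (by linarith) hd0.le
        have h5 : 100 * (d * L) * (1 / 3) ≤ 100 * (d * L) * Real.log (3 / 2) :=
          mul_le_mul_of_nonneg_left hl3 (by positivity)
        nlinarith
    _ = √(d * Δ) := by
        rw [← Real.log_sqrt hx.le, Real.exp_log (Real.sqrt_pos.2 hx)]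

end Numeric

/-! ### Atypical blocks -/

section Blocks

variable {𝒳 : Type*}

lemma card_filter_block (j : ℕ) (q : ℕ → Prop) [DecidablePred q] :
    ((Finset.Ico (2 ^ j) (2 ^ (j + 1))).filter q).card =
      (Finset.univ.filter fun i : Fin (2 ^ j) => q (2 ^ j + i)).card := by
  rw [Finset.card_filter, Finset.card_filter, Finset.sum_Ico_eq_sum_range,
    show 2 ^ (j + 1) - 2 ^ j = 2 ^ j by rw [pow_succ]; omega,
    Finset.sum_range fun i => if q (2 ^ j + i) then 1 else 0]

variable [MeasurableSpace 𝒳] {P : Measure 𝒳} [IsProbabilityMeasure P]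

lemma disagreement_le_one (f g : 𝒳 → Bool) : disagreement P f g ≤ 1 := measureReal_le_one

lemma disagreement_triangle (f g h : 𝒳 → Bool) :
    disagreement P f h ≤ disagreement P f g + disagreement P g h := by
  refine le_trans (measureReal_mono ?_) (measureReal_union_le _ _)
  intro x hx
  by_cases h1 : f x = g x
  · exact Or.inr fun h2 => hx (h1.trans h2)
  · exact Or.inl h1

lemma disagreement_drift_le {C : Set (𝒳 → Bool)} {Δ : ℝ} {hs : ℕ → 𝒳 → Bool}
    (h : hs ∈ driftClass P C Δ) (t p : ℕ) : disagreement P (hs t) (hs (t + p)) ≤ p * Δ := by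
  induction p with
  | zero => simp [disagreement]
  | succ p ih =>
    have := disagreement_triangle (P := P) (hs t) (hs (t + p)) (hs (t + (p + 1)))
    have h2 := h.2 (t + p)
    push_cast
    rw [← add_assoc] at this ⊢
    linarith

open Classical in
/-- The atypical outcomes of block `j` of a batch starting at `t`: the first target of the batch
makes too many mistakes, or some concept far from it has too few disagreements with it. -/
def atypicalBlock (P : Measure 𝒳) (C : Set (𝒳 → Bool)) (d : ℕ) (Δ : ℝ) (hs : ℕ → 𝒳 → Bool)
    (t j : ℕ) : Set (Fin (2 ^ j) → 𝒳) :=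
  {v | threshold d Δ j ≤
      ((Finset.univ.filter fun i : Fin (2 ^ j) =>
        v i ∈ {x | hs t x ≠ hs (t + (2 ^ j + i)) x}).card : ℝ)} ∪
  {v | ∃ h ∈ C, survivorRadius d Δ j < disagreement P h (hs t) ∧
    ((Finset.univ.filter fun i => h (v i) ≠ hs t (v i)).card : ℝ) ≤ 3 * threshold d Δ j}

lemma measure_atypicalBlock_le {C : Set (𝒳 → Bool)} (hC : MeasurableClass P C) {d : ℕ}
    (hd : 1 ≤ d) (hvc : vcDim C ≤ d) {Δ : ℝ} (hΔ : 0 < Δ) {hs : ℕ → 𝒳 → Bool}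
    (hdr : hs ∈ driftClass P C Δ) (t : ℕ) {j : ℕ} (hj : ((2 : ℝ) ^ j) ^ 2 * Δ ≤ d) :
    (Measure.pi fun _ => P) (atypicalBlock P C d Δ hs t j) ≤
      ENNReal.ofReal (2 * √(d * Δ)) := by
  classical
  have hd1 : (1 : ℝ) ≤ d := by exact_mod_cast hd
  have hmeas : ∀ n, Measurable (hs n) := fun n => hC.measurable _ (hdr.1 n)
  have hm : (0 : ℝ) < 2 ^ j := by positivity
  rw [two_mul, ENNReal.ofReal_add (Real.sqrt_nonneg _) (Real.sqrt_nonneg _)]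
  refine (measure_union_le _ _).trans (add_le_add ?_ ?_)
  · have hl2 : 0 < Real.log 2 := Real.log_pos (by norm_num)
    have h := measure_count_le P
      (A := fun i : Fin (2 ^ j) => {x | hs t x ≠ hs (t + (2 ^ j + i)) x})
      (fun i => (measurableSet_eq_fun (hmeas _) (hmeas _)).compl) (Real.log 2)
      (threshold d Δ j * Real.log 2)
    have hsum : ∑ i : Fin (2 ^ j), P.real {x | hs t x ≠ hs (t + (2 ^ j + i)) x} ≤
        2 ^ j * (2 ^ (j + 1) * Δ) := by
      calc _ ≤ ∑ _i : Fin (2 ^ j), 2 ^ (j + 1) * Δ := by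
            refine Finset.sum_le_sum fun i _ => (disagreement_drift_le hdr t (2 ^ j + i)).trans ?_
            have : ((2 ^ j + i : ℕ) : ℝ) ≤ 2 ^ (j + 1) := by
              have h1 : 2 ^ j + (i : ℕ) ≤ 2 ^ (j + 1) := by
                have := i.2
                rw [pow_succ]; omega
              exact_mod_cast h1
            exact mul_le_mul_of_nonneg_right this hΔ.le
        _ = 2 ^ j * (2 ^ (j + 1) * Δ) := by simp
    rw [Real.exp_log (by norm_num), show (2 : ℝ) - 1 = 1 by norm_num, one_mul] at h
    refine ENNReal.le_ofReal_iff_toReal_le (measure_ne_top _ _) (Real.sqrt_nonneg _) |>.2 ?_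
    refine le_trans ?_ (h.trans ((Real.exp_le_exp.2 (by linarith)).trans
      (chernoff_exponent_le hd hΔ j)))
    refine measureReal_mono fun v hv => ?_
    simp only [Set.mem_ofPred_eq] at hv ⊢
    rw [mul_comm]
    exact mul_le_mul_of_nonneg_left hv hl2.le
  · -- a radius of at least one makes the event void, so the block may be assumed long
    rcases le_or_gt 1 (survivorRadius d Δ j) with hr | hr
    · refine le_of_eq_of_le (measure_mono_null (t := ∅) ?_ measure_empty) zero_le
      rintro v ⟨h, -, hfar, -⟩
      exact absurd (hr.trans_lt hfar) (not_lt.2 (disagreement_le_one _ _))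
    · have hL1 := one_le_Log (1 / (d * Δ))
      have hsr : survivorRadius d Δ j * 2 ^ j = 200 * d * Log (1 / (d * Δ)) := by
        rw [survivorRadius, div_mul_cancel₀ _ hm.ne']
      have hlong : 200 * d * Log (1 / (d * Δ)) < 2 ^ j := by
        rw [← hsr]; nlinarith
      have h := measure_exists_far_of_few_le hC hvc hd (hdr.1 t) (m := 2 ^ j)
        (r := survivorRadius d Δ j) (by
          have h1 : (d : ℝ) ≤ 2 * 2 ^ j := by nlinarith
          exact_mod_cast h1) (by push_cast; rw [hsr]; nlinarith) (3 * threshold d Δ j)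
      refine h.trans (ENNReal.ofReal_le_ofReal ?_)
      push_cast
      exact deviation_exponent_le hd hΔ hj

end Blocks

/-! ### The batch length -/

section BatchLength

variable {d : ℕ} {Δ : ℝ}

lemma le_batchLength (hd : 1 ≤ d) (hΔ : 0 < Δ) : √(d / Δ) ≤ batchLength 1 d Δ := by
  have hd0 : (0 : ℝ) < d := by exact_mod_cast hd
  have h0 : 0 < √(d / Δ) := Real.sqrt_pos.2 (by positivity)
  rw [batchLength, one_mul]
  push_cast
  rw [← Real.rpow_natCast, ← Real.logb_le_iff_le_rpow (by norm_num) h0]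
  exact Nat.le_ceil _

lemma batchLength_le (hd : 1 ≤ d) (hΔ : 0 < Δ) (hΔ1 : Δ ≤ 1) :
    (batchLength 1 d Δ : ℝ) ≤ 2 * √(d / Δ) := by
  have hd1 : (1 : ℝ) ≤ d := by exact_mod_cast hd
  have h1 : 1 ≤ √(d / Δ) := by
    rw [Real.one_le_sqrt, one_le_div hΔ]; linarith
  have h0 : 0 < √(d / Δ) := by linarith
  rw [batchLength, one_mul]
  push_cast
  rw [← Real.rpow_natCast, ← Real.le_logb_iff_rpow_le (by norm_num) (by positivity),
    Real.logb_mul (by norm_num) h0.ne', Real.logb_self_eq_one (by norm_num)]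
  have := Nat.ceil_lt_add_one (Real.logb_nonneg (b := 2) (by norm_num) h1)
  linarith

lemma batchLength_pos (c : ℝ) : 0 < batchLength c d Δ := by
  unfold batchLength; positivity

lemma sq_block_mul_le (hd : 1 ≤ d) (hΔ : 0 < Δ) (hΔ1 : Δ ≤ 1) {j : ℕ}
    (hj : 2 ^ (j + 1) ≤ batchLength 1 d Δ) : ((2 : ℝ) ^ j) ^ 2 * Δ ≤ d := by
  have hd0 : (0 : ℝ) < d := by exact_mod_cast hd
  have h1 : (2 : ℝ) ^ (j + 1) ≤ batchLength 1 d Δ := by exact_mod_cast hj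
  have h2 : (2 : ℝ) ^ j ≤ √(d / Δ) := by
    have := h1.trans (batchLength_le hd hΔ hΔ1)
    rw [pow_succ] at this; linarith
  rw [← le_div_iff₀ hΔ]
  exact (Real.le_sqrt (by positivity) (by positivity)).1 h2

end BatchLength

/-! ### Error and query probabilities of a single instance -/

section Instances

variable {𝒳 Ω : Type*} [MeasurableSpace 𝒳] {P : Measure 𝒳}
  {mΩ : MeasurableSpace Ω} {μ : Measure Ω}
  {ℱ : Filtration ℕ mΩ} {X : ℕ → Ω → 𝒳} {C : Set (𝒳 → Bool)} {d : ℕ} {Δ : ℝ}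
  {hs : ℕ → 𝒳 → Bool} {hhat : ℕ → ℕ → Ω → 𝒳 → Bool} {M : ℕ}

/-- Outside an event of small probability that is decided before block `k` of a batch, the first
target of the batch is still a candidate, and all candidates are close to it. -/
lemma exists_atypical_event [IsProbabilityMeasure P] [IsProbabilityMeasure μ]
    (hS : IsAdaptedSample P μ ℱ X) (hC : MeasurableClass P C)
    (hd : 1 ≤ d) (hvc : vcDim C ≤ d) (hΔ : 0 < Δ) (hdr : hs ∈ driftClass P C Δ)
    (hrun : IsDriftingActiveRun C (threshold d Δ) M hs X ℱ hhat)
    (hM : ∀ j, 2 ^ (j + 1) ≤ M → ((2 : ℝ) ^ j) ^ 2 * Δ ≤ d) (i k : ℕ) (hk : 2 ^ k ≤ M) :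
    ∃ F, MeasurableSet[ℱ (M * i + 2 ^ k)] F ∧ μ F ≤ ENNReal.ofReal (k * (2 * √(d * Δ))) ∧
      ∀ ω, ω ∉ F → hs (M * i) ∈ batchVersionSpace C (threshold d Δ) M hs X hhat i k ω ∧
        ∀ j, j + 1 = k →
          hhat i k ω ∈ batchVersionSpace C (threshold d Δ) M hs X hhat i k ω ∧
          ∀ h ∈ batchVersionSpace C (threshold d Δ) M hs X hhat i k ω,
            disagreement P h (hs (M * i)) ≤ survivorRadius d Δ j := by
  classical
  let blk : (j : ℕ) → Ω → Fin (2 ^ j) → 𝒳 := fun j ω q => X (M * i + (2 ^ j + q)) ω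
  let A : (j : ℕ) → Set (Fin (2 ^ j) → 𝒳) := fun j =>
    toMeasurable (Measure.pi fun _ => P) (atypicalBlock P C d Δ hs (M * i) j)
  have hA : ∀ j, MeasurableSet (A j) := fun j => measurableSet_toMeasurable _ _
  have hpow : ∀ j < k, 2 ^ (j + 1) ≤ 2 ^ k := fun j hj => Nat.pow_le_pow_right (by norm_num) hj
  have hpowM : ∀ j < k, 2 ^ (j + 1) ≤ M := fun j hj => (hpow j hj).trans hk
  refine ⟨⋃ j ∈ Finset.range k, blk j ⁻¹' A j, ?_, ?_, ?_⟩
  · refine Finset.measurableSet_biUnion _ fun j hj => ?_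
    have hm : Measurable[ℱ (M * i + 2 ^ k)] (blk j) := by
      refine @measurable_pi_lambda _ _ _ (ℱ (M * i + 2 ^ k)) _ _ fun q => ?_
      refine (hS.adapted _).mono (ℱ.mono ?_) le_rfl
      have h1 := hpow j (Finset.mem_range.1 hj)
      have h2 := q.2
      rw [pow_succ] at h1
      omega
    exact hm (hA j)
  · refine (measure_biUnion_finset_le _ _).trans ?_
    calc ∑ j ∈ Finset.range k, μ (blk j ⁻¹' A j)
        ≤ ∑ _j ∈ Finset.range k, ENNReal.ofReal (2 * √(d * Δ)) := by
          refine Finset.sum_le_sum fun j hj => ?_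
          have hinj : Function.Injective fun q : Fin (2 ^ j) => M * i + (2 ^ j + (q : ℕ)) := by
            intro q q' h
            exact Fin.ext (by simpa using h)
          rw [(hS.measurePreserving_sample hinj).measure_preimage (hA j).nullMeasurableSet,
            measure_toMeasurable]
          exact measure_atypicalBlock_le hC hd hvc hΔ hdr _
            (hM j (hpowM j (Finset.mem_range.1 hj)))
      _ = ENNReal.ofReal (k * (2 * √(d * Δ))) := by
          rw [Finset.sum_const, Finset.card_range, nsmul_eq_mul,
            ENNReal.ofReal_mul (Nat.cast_nonneg k), ENNReal.ofReal_natCast]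
  · intro ω hω
    simp only [Set.mem_iUnion, Finset.mem_range, not_exists] at hω
    have htyp : ∀ j < k, blk j ω ∉ atypicalBlock P C d Δ hs (M * i) j := fun j hj h =>
      hω j hj (subset_toMeasurable _ _ h)
    refine versionSpace_good (r := survivorRadius d Δ) (hdr.1 _)
      (fun j hj => hrun.step_argmin i j ω (hpowM j hj)) ?_ ?_
    · intro j hj
      have h := fun h' => htyp j hj (Or.inl h')
      rw [card_filter_block]
      exact (not_le.1 h).le
    · intro j hj h hhC hfew
      by_contra hfar
      refine htyp j hj (Or.inr ⟨h, hhC, not_le.1 hfar, ?_⟩)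
      rw [card_filter_block] at hfew
      exact hfew

lemma measurable_prediction (hS : IsAdaptedSample P μ ℱ X)
    (hrun : IsDriftingActiveRun C (threshold d Δ) M hs X ℱ hhat) (i k : ℕ) (hk : 2 ^ k ≤ M)
    (n : ℕ) : Measurable fun ω => hhat i k ω (X n ω) := by
  have h : Measurable fun q : Ω × 𝒳 => hhat i k q.1 q.2 := by
    cases k with
    | zero => exact (hrun.init_measurable i).mono (sup_le_sup_right
        (MeasurableSpace.comap_mono (ℱ.le _)) _) le_rfl
    | succ k => exact (hrun.step_measurable i k hk).mono (sup_le_sup_right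
        (MeasurableSpace.comap_mono (ℱ.le _)) _) le_rfl
  exact h.comp (measurable_id.prodMk (hS.measurable n))

/-- The probability of a mistake at position `p` of a batch, in block `j + 1`: either the batch is
atypical, or the classifier errs against the first target of the batch, or the target has
drifted. -/
lemma measure_mistake_le [IsProbabilityMeasure P] [IsProbabilityMeasure μ]
    (hS : IsAdaptedSample P μ ℱ X) (hC : MeasurableClass P C)
    (hd : 1 ≤ d) (hvc : vcDim C ≤ d) (hΔ : 0 < Δ) (hdr : hs ∈ driftClass P C Δ)
    (hrun : IsDriftingActiveRun C (threshold d Δ) M hs X ℱ hhat)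
    (hM : ∀ j, 2 ^ (j + 1) ≤ M → ((2 : ℝ) ^ j) ^ 2 * Δ ≤ d) (i j p : ℕ)
    (hp : 2 ^ (j + 1) ≤ p) (hpM : p < M) :
    μ {ω | hhat i (j + 1) ω (X (M * i + p) ω) ≠ hs (M * i + p) (X (M * i + p) ω)} ≤
      ENNReal.ofReal (survivorRadius d Δ j + ((j + 1 : ℕ) * (2 * √(d * Δ)) + p * Δ)) := by
  set n := M * i + p with hn
  set h₀ := hs (M * i)
  have hkM : 2 ^ (j + 1) ≤ M := hp.trans hpM.le
  have hle : M * i + 2 ^ (j + 1) ≤ n := by omega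
  have hh₀ : Measurable h₀ := hC.measurable _ (hdr.1 _)
  have hr0 : 0 ≤ survivorRadius d Δ j := by
    have := one_le_Log (1 / (d * Δ))
    unfold survivorRadius; positivity
  obtain ⟨F, -, hFμ, hF⟩ := exists_atypical_event hS hC hd hvc hΔ hdr hrun hM i (j + 1) hkM
  let D : Set (Ω × 𝒳) := {q | hhat i (j + 1) q.1 q.2 ≠ h₀ q.2 ∧
    P {x | hhat i (j + 1) q.1 x ≠ h₀ x} ≤ ENNReal.ofReal (survivorRadius d Δ j)}
  have hD : MeasurableSet[(ℱ n).prod inferInstance] D := by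
    let _ : MeasurableSpace Ω := ℱ n
    have hg : Measurable fun q : Ω × 𝒳 => hhat i (j + 1) q.1 q.2 :=
      (hrun.step_measurable i j hkM).mono (sup_le_sup_right
        (MeasurableSpace.comap_mono (ℱ.mono hle)) _) le_rfl
    have hne : MeasurableSet {q : Ω × 𝒳 | hhat i (j + 1) q.1 q.2 ≠ h₀ q.2} :=
      (measurableSet_eq_fun hg (hh₀.comp measurable_snd)).compl
    have hP : Measurable fun ω : Ω => P {x | hhat i (j + 1) ω x ≠ h₀ x} :=
      measurable_measure_prodMk_left hne
    exact hne.inter (measurableSet_le (hP.comp measurable_fst) measurable_const)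
  have hDμ : μ {ω | (ω, X n ω) ∈ D} ≤ ENNReal.ofReal (survivorRadius d Δ j) := by
    refine hS.measure_section_le hD fun ω => ?_
    by_cases h : P {x | hhat i (j + 1) ω x ≠ h₀ x} ≤ ENNReal.ofReal (survivorRadius d Δ j)
    · exact (measure_mono fun x hx => hx.1).trans h
    · refine le_of_eq_of_le (measure_mono_null (t := ∅) ?_ measure_empty) zero_le
      exact fun x hx => h hx.2
  have hdrift : μ (X n ⁻¹' {x | h₀ x ≠ hs n x}) ≤ ENNReal.ofReal (p * Δ) := by
    refine (hS.measure_preimage_le n _).trans ?_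
    rw [ENNReal.le_ofReal_iff_toReal_le (measure_ne_top _ _) (by positivity)]
    exact disagreement_drift_le hdr (M * i) p
  rw [ENNReal.ofReal_add hr0 (by positivity), ENNReal.ofReal_add (by positivity) (by positivity)]
  refine le_trans (measure_mono ?_) ((measure_union_le _ _).trans (add_le_add hDμ
    ((measure_union_le _ _).trans (add_le_add hFμ hdrift))))
  intro ω hω
  by_cases hωF : ω ∈ F
  · exact Or.inr (Or.inl hωF)
  by_cases hωd : h₀ (X n ω) = hs n (X n ω)
  · refine Or.inl ⟨fun h => hω (h.trans hωd), ?_⟩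
    have h := ((hF ω hωF).2 j rfl)
    rw [ENNReal.le_ofReal_iff_toReal_le (measure_ne_top _ _) hr0]
    exact h.2 _ h.1
  · exact Or.inr (Or.inr hωd)

lemma measure_DIS_ball_le {h : 𝒳 → Bool} (hh : h ∈ C) {r r₀ : ℝ} (hr₀ : 0 ≤ r₀) (hr : r₀ < r) :
    P (DIS (ball P C h r)) ≤ worstDisCoeff P C r₀ * ENNReal.ofReal r := by
  have h1 : P (DIS (ball P C h r)) / ENNReal.ofReal r ≤ worstDisCoeff P C r₀ :=
    (le_iSup₂ (f := fun (r : ℝ) (_ : r₀ < r) => P (DIS (ball P C h r)) / ENNReal.ofReal r)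
      r hr).trans (le_iSup₂ (f := fun h (_ : h ∈ C) => disCoeff P C h r₀) h hh)
  have hr0 : 0 < r := hr₀.trans_lt hr
  exact (ENNReal.div_le_iff (by simpa using hr0) ENNReal.ofReal_ne_top).1 h1

lemma measure_DIS_le [IsProbabilityMeasure P] {h : 𝒳 → Bool} (hh : h ∈ C) {r r₀ : ℝ}
    (hr₀ : 0 ≤ r₀) (hr : r₀ < r) (hr1 : 1 ≤ r) :
    P (DIS C) ≤ worstDisCoeff P C r₀ * ENNReal.ofReal r := by
  refine (measure_mono (DIS_mono ?_)).trans (measure_DIS_ball_le hh hr₀ hr)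
  exact fun g hg => ⟨hg, (disagreement_le_one _ _).trans hr1⟩

/-- The probability of a label request at position `p` of a batch, in block `j + 1`: either all
candidates are in a small ball around the first target of the batch, or the batch is atypical and
the point nevertheless lies in `DIS C`. -/
lemma measure_query_le [IsProbabilityMeasure P] [IsProbabilityMeasure μ]
    (hS : IsAdaptedSample P μ ℱ X) (hC : MeasurableClass P C)
    (hd : 1 ≤ d) (hvc : vcDim C ≤ d) (hΔ : 0 < Δ) (hdr : hs ∈ driftClass P C Δ)
    (hrun : IsDriftingActiveRun C (threshold d Δ) M hs X ℱ hhat)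
    (hM : ∀ j, 2 ^ (j + 1) ≤ M → ((2 : ℝ) ^ j) ^ 2 * Δ ≤ d) (i j p : ℕ)
    (hp : 2 ^ (j + 1) ≤ p) (hpM : p < M) {r₀ : ℝ} (hr₀ : 0 ≤ r₀) (hr₀1 : r₀ < 1)
    (hr : r₀ < survivorRadius d Δ j) :
    μ {ω | X (M * i + p) ω ∈
        DIS (batchVersionSpace C (threshold d Δ) M hs X hhat i (j + 1) ω)} ≤
      worstDisCoeff P C r₀ *
        ENNReal.ofReal (survivorRadius d Δ j + (j + 1 : ℕ) * (2 * √(d * Δ))) := by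
  set n := M * i + p with hn
  have hkM : 2 ^ (j + 1) ≤ M := hp.trans hpM.le
  have hle : M * i + 2 ^ (j + 1) ≤ n := by omega
  obtain ⟨F, hFm, hFμ, hF⟩ := exists_atypical_event hS hC hd hvc hΔ hdr hrun hM i (j + 1) hkM
  have h1 : μ (X n ⁻¹' DIS (ball P C (hs (M * i)) (survivorRadius d Δ j))) ≤
      worstDisCoeff P C r₀ * ENNReal.ofReal (survivorRadius d Δ j) :=
    (hS.measure_preimage_le n _).trans (measure_DIS_ball_le (hdr.1 _) hr₀ hr)
  have h2 : μ (F ∩ X n ⁻¹' DIS C) ≤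
      worstDisCoeff P C r₀ * ENNReal.ofReal ((j + 1 : ℕ) * (2 * √(d * Δ))) := by
    refine (hS.measure_past_inter_le (ℱ.mono hle _ hFm) _).trans ?_
    rw [mul_comm]
    refine mul_le_mul' ?_ hFμ
    simpa using measure_DIS_le (P := P) (hdr.1 0) hr₀ hr₀1 le_rfl
  rw [ENNReal.ofReal_add (hr₀.trans hr.le) (by positivity), mul_add]
  refine le_trans (measure_mono ?_) ((measure_union_le _ _).trans (add_le_add h1 h2))
  intro ω hω
  by_cases hωF : ω ∈ F
  · exact Or.inr ⟨hωF, DIS_mono versionSpace_subset hω⟩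
  · refine Or.inl (DIS_mono ?_ hω)
    exact fun h hh => ⟨versionSpace_subset hh, ((hF ω hωF).2 j rfl).2 h hh⟩

end Instances

/-! ### Expected counts -/

section Counting

open Classical in
lemma lintegral_card_filter {Ω : Type*} {mΩ : MeasurableSpace Ω} {μ : Measure Ω}
    {q : ℕ → Ω → Prop} (hq : ∀ n, NullMeasurableSet {ω | q n ω} μ) {T : ℕ} {N : Ω → ℕ}
    (hN : ∀ ω, N ω = ((Finset.range T).filter fun n => q n ω).card) :
    AEMeasurable (fun ω => (N ω : ℝ≥0∞)) μ ∧
      ∫⁻ ω, (N ω : ℝ≥0∞) ∂μ = ∑ n ∈ Finset.range T, μ {ω | q n ω} := by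
  have hcount : (fun ω => (N ω : ℝ≥0∞)) =
      fun ω => ∑ n ∈ Finset.range T, {ω | q n ω}.indicator (fun _ => (1 : ℝ≥0∞)) ω := by
    funext ω
    rw [hN, Finset.card_filter]
    push_cast
    refine Finset.sum_congr rfl fun n _ => ?_
    simp [Set.indicator_apply]
  have hae : ∀ n, AEMeasurable ({ω | q n ω}.indicator fun _ => (1 : ℝ≥0∞)) μ := fun n =>
    aemeasurable_const.indicator₀ (hq n)
  rw [hcount]
  refine ⟨Finset.aemeasurable_fun_sum _ fun n _ => hae n, ?_⟩
  rw [lintegral_finsetSum' _ fun n _ => hae n]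
  exact Finset.sum_congr rfl fun n _ => lintegral_indicator_one₀ (hq n)

lemma sum_measure_le {q : ℕ → ℝ≥0∞} {θ : ℝ≥0∞} {g : ℕ → ℝ} (hg : ∀ n, 0 ≤ g n)
    (hq : ∀ n, q n ≤ θ * ENNReal.ofReal (g n)) {T : ℕ} {b : ℝ}
    (hb : ∑ n ∈ Finset.range T, g n ≤ b) :
    ∑ n ∈ Finset.range T, q n ≤ θ * ENNReal.ofReal b := by
  calc ∑ n ∈ Finset.range T, q n ≤ ∑ n ∈ Finset.range T, θ * ENNReal.ofReal (g n) :=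
        Finset.sum_le_sum fun n _ => hq n
    _ = θ * ENNReal.ofReal (∑ n ∈ Finset.range T, g n) := by
        rw [← Finset.mul_sum, ENNReal.ofReal_sum_of_nonneg fun n _ => hg n]
    _ ≤ θ * ENNReal.ofReal b := by gcongr

/-- A horizon `T ≥ M` contains at most `2 T / M` complete or started batches. -/
lemma sum_mod_le {f : ℕ → ℝ} (hf : ∀ p, 0 ≤ f p) {M T : ℕ} (hM : 0 < M) (hT : M ≤ T) :
    ∑ n ∈ Finset.range T, f (n % M) ≤ 2 * T / M * ∑ p ∈ Finset.range M, f p := by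
  have hbatches : ∀ B : ℕ, ∑ n ∈ Finset.range (M * B), f (n % M) =
      B * ∑ p ∈ Finset.range M, f p := by
    intro B
    induction B with
    | zero => simp
    | succ B ih =>
      rw [Nat.mul_succ, Finset.sum_range_add, ih]
      have : ∀ p ∈ Finset.range M, f ((M * B + p) % M) = f p := fun p hp => by
        rw [Nat.mul_add_mod, Nat.mod_eq_of_lt (Finset.mem_range.1 hp)]
      rw [Finset.sum_congr rfl this]
      push_cast; ring
  have h0 : 0 ≤ ∑ p ∈ Finset.range M, f p := Finset.sum_nonneg fun p _ => hf p
  have h1 : T ≤ M * (T / M + 1) := (Nat.lt_mul_div_succ T hM).le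
  have h2 : ((T / M + 1 : ℕ) : ℝ) ≤ 2 * T / M := by
    have hM0 : (0 : ℝ) < M := by exact_mod_cast hM
    have h3 : ((T / M : ℕ) : ℝ) ≤ T / M := Nat.cast_div_le
    have h4 : (1 : ℝ) ≤ T / M := by
      rw [one_le_div hM0]; exact_mod_cast hT
    push_cast
    rw [mul_div_assoc]
    linarith
  calc ∑ n ∈ Finset.range T, f (n % M) ≤ ∑ n ∈ Finset.range (M * (T / M + 1)), f (n % M) :=
        Finset.sum_le_sum_of_subset_of_nonneg (Finset.range_mono h1) fun n _ _ => hf _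
    _ = (T / M + 1 : ℕ) * ∑ p ∈ Finset.range M, f p := hbatches _
    _ ≤ 2 * T / M * ∑ p ∈ Finset.range M, f p := mul_le_mul_of_nonneg_right h2 h0

end Counting

/-! ### Summation over a batch -/

section Rate

/-- A bound for the error probability at position `p` of a batch. The first term is the radius of
the candidate set, the second accounts for atypical batches and for the drift. -/
noncomputable def positionRate (d : ℕ) (Δ : ℝ) (p : ℕ) : ℝ :=
  1600 * d * Log (1 / (d * Δ)) / (p + 1) + 6 * Log (d / Δ) * √(d * Δ)

variable {d : ℕ} {Δ : ℝ}

lemma positionRate_nonneg (p : ℕ) : 0 ≤ positionRate d Δ p := by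
  have h1 := one_le_Log (1 / (d * Δ))
  have h2 := one_le_Log (d / Δ)
  unfold positionRate
  positivity

lemma one_le_positionRate (hd : 1 ≤ d) {p : ℕ} (hp : p ≤ 1) : 1 ≤ positionRate d Δ p := by
  have hd1 : (1 : ℝ) ≤ d := by exact_mod_cast hd
  have h1 := one_le_Log (1 / (d * Δ))
  have h2 := one_le_Log (d / Δ)
  have hp1 : (p : ℝ) ≤ 1 := by exact_mod_cast hp
  have h3 : 1 ≤ 1600 * d * Log (1 / (d * Δ)) / (p + 1) := by
    rw [one_le_div (by positivity)]
    nlinarith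
  have h4 : 0 ≤ 6 * Log (d / Δ) * √(d * Δ) := by positivity
  unfold positionRate
  linarith

lemma sqrt_div_mul_sqrt (hΔ : 0 < Δ) : √(d / Δ) * √(d * Δ) = d := by
  rw [← Real.sqrt_mul (by positivity), show (d : ℝ) / Δ * (d * Δ) = d * d by field_simp,
    Real.sqrt_mul_self (Nat.cast_nonneg d)]

lemma sqrt_div_mul_self (hΔ : 0 < Δ) : √(d / Δ) * Δ = √(d * Δ) := by
  nth_rw 2 [← Real.sqrt_sq hΔ.le]
  rw [← Real.sqrt_mul (by positivity)]
  congr 1; field_simp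

lemma log_batchLength_le (hd : 1 ≤ d) (hΔ : 0 < Δ) (hΔ1 : Δ ≤ 1) :
    Real.log (batchLength 1 d Δ) ≤ Real.log 2 + Log (d / Δ) / 2 := by
  have hd0 : (0 : ℝ) < d := by exact_mod_cast hd
  have hq : 0 < (d : ℝ) / Δ := by positivity
  have h1 : Real.log (batchLength 1 d Δ) ≤ Real.log (2 * √(d / Δ)) :=
    Real.log_le_log (by exact_mod_cast batchLength_pos 1) (batchLength_le hd hΔ hΔ1)
  rw [Real.log_mul (by norm_num) (Real.sqrt_pos.2 hq).ne', Real.log_sqrt hq.le] at h1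
  linarith [log_le_Log hq]

lemma survivorRadius_add_le_positionRate (hd : 1 ≤ d) (hΔ : 0 < Δ) (hΔ1 : Δ ≤ 1) {j p : ℕ}
    (hp : 2 ^ (j + 1) ≤ p) (hp' : p < 2 ^ (j + 2)) (hpM : p < batchLength 1 d Δ) :
    survivorRadius d Δ j + ((j + 1 : ℕ) * (2 * √(d * Δ)) + p * Δ) ≤ positionRate d Δ p := by
  have hL := one_le_Log (1 / (d * Δ))
  have hΛ := one_le_Log (d / Δ)
  have hs := Real.sqrt_nonneg (d * Δ)
  have h1 : survivorRadius d Δ j ≤ 1600 * d * Log (1 / (d * Δ)) / (p + 1) := by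
    have h : (p : ℝ) + 1 ≤ 4 * 2 ^ j := by
      have : p + 1 ≤ 4 * 2 ^ j := by
        rw [pow_add] at hp'; omega
      exact_mod_cast this
    have hm : (0 : ℝ) < 2 ^ j := by positivity
    rw [survivorRadius, div_le_div_iff₀ hm (by positivity)]
    have hdL : 0 ≤ 200 * d * Log (1 / (d * Δ)) := by positivity
    nlinarith [mul_le_mul_of_nonneg_left h hdL, mul_nonneg hdL hm.le]
  have h2 : ((j + 1 : ℕ) : ℝ) ≤ 2 * Log (d / Δ) := by
    have h3 : ((2 ^ (j + 1) : ℕ) : ℝ) ≤ batchLength 1 d Δ := by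
      exact_mod_cast (hp.trans hpM.le)
    have h4 := (Real.log_le_log (by positivity) h3).trans (log_batchLength_le hd hΔ hΔ1)
    rw [Nat.cast_pow, Real.log_pow] at h4
    have h5 := Real.log_two_gt_d9
    push_cast at h4 ⊢
    nlinarith
  have h3 : p * Δ ≤ 2 * √(d * Δ) := by
    rw [← sqrt_div_mul_self hΔ, ← mul_assoc]
    refine mul_le_mul_of_nonneg_right ?_ hΔ.le
    exact le_trans (by exact_mod_cast hpM.le) (batchLength_le hd hΔ hΔ1)
  have h4 := mul_le_mul_of_nonneg_right h2 (by positivity : 0 ≤ 2 * √(d * Δ))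
  unfold positionRate
  nlinarith

lemma epsDelta_lt_survivorRadius (hd : 1 ≤ d) (hΔ : 0 < Δ) (hΔ1 : Δ ≤ 1) {j : ℕ}
    (hj : 2 ^ (j + 1) ≤ batchLength 1 d Δ) : epsDelta d Δ < survivorRadius d Δ j := by
  have hd0 : (0 : ℝ) < d := by exact_mod_cast hd
  have hL := one_le_Log (1 / (d * Δ))
  have hm : (0 : ℝ) < 2 ^ j := by positivity
  have h1 : (2 : ℝ) ^ j ≤ √(d / Δ) := by
    have h2 : (2 : ℝ) ^ (j + 1) ≤ batchLength 1 d Δ := by exact_mod_cast hj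
    have := h2.trans (batchLength_le hd hΔ hΔ1)
    rw [pow_succ] at this; linarith
  have h2 := mul_le_mul_of_nonneg_right h1 (Real.sqrt_nonneg (d * Δ))
  rw [sqrt_div_mul_sqrt hΔ] at h2
  rw [survivorRadius, epsDelta, lt_div_iff₀ hm]
  nlinarith

/-- Over a batch the radii form a harmonic sum, of order `d * Log (1 / (dΔ)) * Log (d / Δ)`, and
`d ≤ M * √(dΔ)` turns this into the rate per instance. -/
lemma sum_positionRate_le (hd : 1 ≤ d) (hΔ : 0 < Δ) (hΔ1 : Δ ≤ 1) :
    ∑ p ∈ Finset.range (batchLength 1 d Δ), positionRate d Δ p ≤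
      batchLength 1 d Δ * (5000 * (epsDelta d Δ * Log (d / Δ))) := by
  set M := batchLength 1 d Δ
  have hd0 : (0 : ℝ) < d := by exact_mod_cast hd
  set L := Log (1 / (d * Δ)) with hLdef
  set Λ := Log (d / Δ)
  have hL : 1 ≤ L := one_le_Log _
  have hΛ : 1 ≤ Λ := one_le_Log _
  have hs := Real.sqrt_nonneg (d * Δ)
  have hharm : ∑ p ∈ Finset.range M, (1 : ℝ) / (p + 1) ≤ 3 * Λ := by
    have h1 := harmonic_le_one_add_log M
    have h2 := log_batchLength_le hd hΔ hΔ1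
    have h3 := Real.log_two_lt_d9
    have h4 : ((harmonic M : ℚ) : ℝ) = ∑ p ∈ Finset.range M, (1 : ℝ) / (p + 1) := by
      simp [harmonic]
    rw [← h4]
    linarith
  have hdM : (d : ℝ) ≤ M * √(d * Δ) := by
    exact (sqrt_div_mul_sqrt hΔ).symm.le.trans
      (mul_le_mul_of_nonneg_right (le_batchLength hd hΔ) hs)
  have hsum : ∑ p ∈ Finset.range M, positionRate d Δ p =
      1600 * (d * L) * ∑ p ∈ Finset.range M, (1 : ℝ) / (p + 1) + M * (6 * Λ * √(d * Δ)) := by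
    simp only [positionRate]
    rw [Finset.sum_add_distrib, Finset.mul_sum, Finset.sum_const, Finset.card_range,
      nsmul_eq_mul]
    congr 1
    refine Finset.sum_congr rfl fun p _ => ?_
    rw [← hLdef]; ring
  rw [hsum, epsDelta, ← hLdef]
  have h1 : 1600 * (d * L) * ∑ p ∈ Finset.range M, (1 : ℝ) / (p + 1) ≤
      1600 * (d * L) * (3 * Λ) := mul_le_mul_of_nonneg_left hharm (by positivity)
  have h2 : d * (L * Λ) ≤ M * √(d * Δ) * (L * Λ) := mul_le_mul_of_nonneg_right hdM (by positivity)
  have h3 : (M * √(d * Δ) * Λ) * 1 ≤ (M * √(d * Δ) * Λ) * L :=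
    mul_le_mul_of_nonneg_left hL (by positivity)
  nlinarith

lemma sum_range_positionRate_le (hd : 1 ≤ d) (hΔ : 0 < Δ) (hΔ1 : Δ ≤ 1) {T : ℕ}
    (hT : batchLength 1 d Δ ≤ T) :
    ∑ n ∈ Finset.range T, positionRate d Δ (n % batchLength 1 d Δ) ≤
      10000 * (epsDelta d Δ * Log (d / Δ) * T) := by
  have hM : (0 : ℝ) < batchLength 1 d Δ := by exact_mod_cast batchLength_pos 1
  refine (sum_mod_le positionRate_nonneg (batchLength_pos 1) hT).trans ?_
  refine (mul_le_mul_of_nonneg_left (sum_positionRate_le hd hΔ hΔ1) (by positivity)).trans ?_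
  rw [div_mul_eq_mul_div, div_le_iff₀ hM]
  linarith

end Rate

end Drift

theorem theorem4 :
    ∃ c₁ : ℝ, 1 ≤ c₁ ∧ ∃ K : ℝ, 0 < K ∧
      ∀ (𝒳 : Type*) [MeasurableSpace 𝒳] (P : Measure 𝒳) [IsProbabilityMeasure P]
        (C : Set (𝒳 → Bool)) (_ : Drift.MeasurableClass P C)
        (d : ℕ) (_ : 1 ≤ d) (_ : Drift.vcDim C = d)
        (Δ : ℝ) (_ : 0 < Δ) (_ : Δ ≤ 1)
        (hs : ℕ → 𝒳 → Bool) (_ : hs ∈ Drift.driftClass P C Δ)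
        (Ω : Type*) (mΩ : MeasurableSpace Ω) (μ : Measure Ω) (_ : IsProbabilityMeasure μ)
        (ℱ : Filtration ℕ mΩ) (X : ℕ → Ω → 𝒳)
        (_ : ∀ n, Measurable[ℱ (n + 1)] (X n))
        (_ : ∀ n, Indep (MeasurableSpace.comap (X n) inferInstance) (ℱ n) μ)
        (_ : ∀ n, μ.map (X n) = P)
        (hhat : ℕ → ℕ → Ω → 𝒳 → Bool)
        (_ : Drift.IsDriftingActiveRun C (Drift.threshold d Δ) (Drift.batchLength c₁ d Δ)
          hs X ℱ hhat)
        (T : ℕ) (_ : Drift.batchLength c₁ d Δ ≤ T),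
        (AEMeasurable (fun ω =>
            (Drift.numMistakes (Drift.batchLength c₁ d Δ) hs X hhat T ω : ℝ≥0∞)) μ ∧
          ∫⁻ ω, (Drift.numMistakes (Drift.batchLength c₁ d Δ) hs X hhat T ω : ℝ≥0∞) ∂μ ≤
            ENNReal.ofReal (K * (Drift.epsDelta d Δ * Drift.Log (d / Δ) * T))) ∧
        (AEMeasurable (fun ω =>
            (Drift.numQueries C (Drift.threshold d Δ) (Drift.batchLength c₁ d Δ)
              hs X hhat T ω : ℝ≥0∞)) μ ∧
          ∫⁻ ω, (Drift.numQueries C (Drift.threshold d Δ) (Drift.batchLength c₁ d Δ)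
              hs X hhat T ω : ℝ≥0∞) ∂μ ≤
            Drift.worstDisCoeff P C (Drift.epsDelta d Δ) *
              ENNReal.ofReal (K * (Drift.epsDelta d Δ * Drift.Log (d / Δ) * T))) := by
  refine ⟨1, le_rfl, 10000, by norm_num, ?_⟩
  intro 𝒳 _ P _ C hC d hd hvc Δ hΔ hΔ1 hs hdr Ω mΩ μ _ ℱ X hX hind hlaw hhat hrun T hT
  have hS : Drift.IsAdaptedSample P μ ℱ X := ⟨hX, hind, hlaw⟩
  have hvc' := hvc.le
  have hMpos : 0 < Drift.batchLength 1 d Δ := Drift.batchLength_pos 1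
  have hblk := fun j (hj : 2 ^ (j + 1) ≤ Drift.batchLength 1 d Δ) =>
    Drift.sq_block_mul_le hd hΔ hΔ1 hj
  have hrate := Drift.sum_range_positionRate_le hd hΔ hΔ1 hT
  set M := Drift.batchLength 1 d Δ with hM
  have hmod : ∀ n, n % M < M := fun n => Nat.mod_lt _ hMpos
  have hdiv : ∀ n, M * (n / M) + n % M = n := fun n => Nat.div_add_mod n M
  have hlogM : ∀ n, 2 ^ Nat.log 2 (n % M) ≤ M := by
    intro n
    by_cases h : n % M = 0
    · rw [h]; exact hMpos
    · exact (Nat.pow_log_le_self 2 h).trans (hmod n).le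
  -- positions `0` and `1` form block `0`; every later position lies in a block `j + 1`
  have hblock : ∀ n, 1 < n % M → ∃ j, Nat.log 2 (n % M) = j + 1 ∧ 2 ^ (j + 1) ≤ n % M ∧
      n % M < 2 ^ (j + 2) := by
    intro n hn
    have hpos : 0 < Nat.log 2 (n % M) := Nat.log_pos (by norm_num) hn
    obtain ⟨j, hj⟩ := Nat.exists_eq_succ_of_ne_zero hpos.ne'
    refine ⟨j, hj, ?_, ?_⟩
    · rw [← Nat.succ_eq_add_one, ← hj]; exact Nat.pow_log_le_self 2 (by omega)
    · have := Nat.lt_pow_succ_log_self (b := 2) (by norm_num) (n % M)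
      rwa [hj] at this
  have htarget : ∀ n, Measurable fun ω => hs n (X n ω) := fun n =>
    (hC.measurable _ (hdr.1 n)).comp (hS.measurable n)
  have hε0 : 0 ≤ Drift.epsDelta d Δ :=
    mul_nonneg (Real.sqrt_nonneg _) (zero_le_one.trans (Drift.one_le_Log _))
  have hΛ := Drift.one_le_Log (d / Δ)
  refine ⟨?_, ?_⟩
  · obtain ⟨h1, h2⟩ := Drift.lintegral_card_filter (μ := μ)
      (q := fun n ω => hhat (n / M) (Nat.log 2 (n % M)) ω (X n ω) ≠ hs n (X n ω))
      (fun n => (measurableSet_eq_fun (Drift.measurable_prediction hS hrun _ _ (hlogM n) n)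
        (htarget n)).compl.nullMeasurableSet) (T := T)
      (N := Drift.numMistakes M hs X hhat T) fun ω => by unfold Drift.numMistakes; congr
    refine ⟨h1, h2.le.trans ?_⟩
    rw [← one_mul (ENNReal.ofReal _)]
    refine Drift.sum_measure_le (fun n => Drift.positionRate_nonneg (n % M)) (fun n => ?_) hrate
    rw [one_mul]
    rcases le_or_gt (n % M) 1 with hp | hp
    · refine prob_le_one.trans ?_
      simpa using Drift.one_le_positionRate hd hp
    · obtain ⟨j, hj, hj1, hj2⟩ := hblock n hp
      have h := Drift.measure_mistake_le hS hC hd hvc' hΔ hdr hrun hblk (n / M) j (n % M)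
        hj1 (hmod n)
      rw [hdiv] at h
      rw [hj]
      exact h.trans (ENNReal.ofReal_le_ofReal
        (Drift.survivorRadius_add_le_positionRate hd hΔ hΔ1 hj1 hj2 (hmod n)))
  · obtain ⟨h1, h2⟩ := Drift.lintegral_card_filter (μ := μ)
      (q := fun n ω => n % M ≠ 0 ∧ X n ω ∈ Drift.DIS (Drift.batchVersionSpace C
        (Drift.threshold d Δ) M hs X hhat (n / M) (Nat.log 2 (n % M)) ω))
      (fun n => by
        by_cases hn : n % M = 0
        · simp [hn]
        · simpa [hn] using Drift.nullMeasurableSet_query hC hS htarget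
            (fun k hk m => Drift.measurable_prediction hS hrun _ _ hk m) _ (hlogM n) n) (T := T)
      (N := Drift.numQueries C (Drift.threshold d Δ) M hs X hhat T)
      fun ω => by unfold Drift.numQueries; congr
    refine ⟨h1, h2.le.trans ?_⟩
    have hDIS : ∀ n, μ {ω | n % M ≠ 0 ∧ X n ω ∈ Drift.DIS (Drift.batchVersionSpace C
        (Drift.threshold d Δ) M hs X hhat (n / M) (Nat.log 2 (n % M)) ω)} ≤
        P (Drift.DIS C) := fun n =>
      (measure_mono (t := X n ⁻¹' Drift.DIS C) fun ω hω =>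
        Drift.DIS_mono Drift.versionSpace_subset hω.2).trans
        (hS.measure_preimage_le n _)
    rcases lt_or_ge (Drift.epsDelta d Δ) 1 with hε | hε
    · refine Drift.sum_measure_le (fun n => Drift.positionRate_nonneg (n % M)) (fun n => ?_) hrate
      rcases le_or_gt (n % M) 1 with hp | hp
      · refine (hDIS n).trans ((Drift.measure_DIS_le (hdr.1 0) hε0 hε le_rfl).trans ?_)
        gcongr
        exact Drift.one_le_positionRate hd hp
      · obtain ⟨j, hj, hj1, hj2⟩ := hblock n hp
        have h := Drift.measure_query_le hS hC hd hvc' hΔ hdr hrun hblk (n / M) j (n % M)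
          hj1 (hmod n) hε0 hε
          (Drift.epsDelta_lt_survivorRadius hd hΔ hΔ1 (hj1.trans (hmod n).le))
        rw [hdiv] at h
        rw [hj]
        refine (measure_mono fun ω hω => hω.2).trans (h.trans ?_)
        gcongr
        refine le_trans ?_
          (Drift.survivorRadius_add_le_positionRate hd hΔ hΔ1 hj1 hj2 (hmod n))
        have : 0 ≤ ((n % M : ℕ) : ℝ) * Δ := by positivity
        linarith
    · -- here the claimed rate exceeds the trivial rate `P (DIS C)`
      refine Drift.sum_measure_le (g := fun _ => 2 * Drift.epsDelta d Δ)
        (fun _ => by positivity)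
        (fun n => (hDIS n).trans (Drift.measure_DIS_le (hdr.1 0) hε0 (by linarith)
          (by linarith))) ?_
      rw [Finset.sum_const, Finset.card_range, nsmul_eq_mul]
      have h3 : Drift.epsDelta d Δ * T ≤ Drift.epsDelta d Δ * T * Drift.Log (d / Δ) :=
        le_mul_of_one_le_right (by positivity) hΛ
      have h4 : 0 ≤ Drift.epsDelta d Δ * T := by positivity
      nlinarith
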